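/- Let $n,m\ge 1$ be integers, $0\le\alpha<nm$, $1<p_i<\infty$ for $i=1,\dots,m$, $\frac1p=\sum_{i=1}^m\frac1{p_i}$, and let $q$ be a real number with $\frac1m<p\le q<\infty$. A *cube* is a nondegenerate cube in $\mathbb R^n$ with sides parallel to the coordinate axes; $|Q|$ is its Lebesgue measure. A *weight* is a non-negative (finite-valued) measurable function on $\mathbb R^n$. A *Young function* is a function $B:[0,\infty)\to[0,\infty)$ of the form $B(t)=\int_0^t b(s)\,ds$ with $b:[0,\infty)\to[0,\infty)$ nondecreasing and not identically zero; $B^{-1}(t)=\inf\{s\ge0: B(s)>t\}$, and we put $B(\infty)=\infty$. For a measurable $g$ with values in $\mathbb R$, $\mathbb C$ or $[0,\infty]$ put $$\|g\|_{B,Q}=\inf\Big\{\lambda>0:\ \frac1{|Q|}\int_Q B(|g|/\lambda)\le 1\Big\}\qquad(\inf\emptyset=\infty).$$ $B$ is *doubling* if $B(2t)\le KB(t)$ for all $t\ge0$ and some constant $K>0$; it satisfies the *$B_r$ condition*, $1<r<\infty$, if $\int_c^\infty \frac{B(t)}{t^r}\frac{dt}{t}<\infty$ for some $c>0$. For $\vec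 f=(f_1,\dots,f_m)$ put $$\mathcal M_{\alpha,B}\vec f(x)=\sup_{Q\ni x}|Q|^{\alpha/n}\prod_{i=1}^m\|f_i\|_{B,Q},$$ the supremum being over all cubes $Q$ containing $x$. Products in $[0,\infty]$ are taken with $0\cdot\infty=0$. **Theorem.** Let $B$, $A_i$, $C_i$ ($i=1,\dots,m$) be Young functions such that, for every $i$, $A_i^{-1}(t)\,C_i^{-1}(t)\le B^{-1}(t)$ for all $t>0$, and $C_i$ is doubling and satisfies the $B_{p_i}$ condition. Let $\nu$ and $\vec w=(w_1,\dots,w_m)$ be weights such that $$\sup_Q\ |Q|^{\frac{\alpha}{n}+\frac1q-\frac1p}\Big(\frac1{|Q|}\int_Q\nu^q\Big)^{1/q}\prod_{i=1}^m\|w_i^{-1}\|_{A_i,Q}<\infty ,$$ where the supremum is over all cubes and $w_i^{-1}=\infty$ wherever $w_i=0$. Then there is a finite constant $C$ such that $$\|(\mathcal M_{\alpha,B}\vec f)\,\nu\|_{L^q}\le C\prod_{i=1}^m\|f_iw_i\|_{L^{p_i}}$$ for every $\vec f\in L^{p_1}(w_1^{p_1})\times\cdots\times L^{p_m}(w_m^{p_m})$.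 -/

import Mathlib

open MeasureTheory Set
open scoped ENNReal NNReal

noncomputable section

/-- `B`, regarded as a function on `[0, ∞)`, is a Young function: `B t = ∫₀ᵗ b` for some
nontrivial, non-negative, nondecreasing `b : [0, ∞) → [0, ∞)`.
The values of `B` at negative numbers are never used. -/
def IsYoungFunction (B : ℝ → ℝ) : Prop :=
  ∃ b : ℝ → ℝ, MonotoneOn b (Ici 0) ∧ (∀ s, 0 ≤ s → 0 ≤ b s) ∧ (∃ s, 0 ≤ s ∧ b s ≠ 0) ∧
    ∀ t, 0 ≤ t → B t = ∫ s in (0 : ℝ)..t, b s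

/-- The inverse `B⁻¹(t) = inf {s ≥ 0 : B s > t}` of a Young function. For `t > 0` this is the
only `s ≥ 0` with `B s = t`. -/
def youngInv (B : ℝ → ℝ) (t : ℝ) : ℝ := sInf {s | 0 ≤ s ∧ t < B s}

/-- The doubling condition. -/
def IsDoublingYoung (B : ℝ → ℝ) : Prop :=
  ∃ K : ℝ, 0 < K ∧ ∀ t, 0 ≤ t → B (2 * t) ≤ K * B t

/-- The `B_r` condition: `∫_c^∞ B(t) / t ^ r dt / t < ∞` for some `c > 0`. -/
def SatisfiesBr (r : ℝ) (B : ℝ → ℝ) : Prop :=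
  ∃ c : ℝ, 0 < c ∧ IntegrableOn (fun t : ℝ => B t / t ^ r * (1 / t)) (Ioi c)

/-- A Young function extended to `[0, ∞]` by `B ∞ = ∞`. -/
def youngExt (B : ℝ → ℝ) (x : ℝ≥0∞) : ℝ≥0∞ :=
  if x = ⊤ then ⊤ else ENNReal.ofReal (B x.toReal)

/-- The `B`-average (Luxemburg norm with respect to normalized Lebesgue measure on `Q`) of a
function `g` with values in `[0, ∞]`; it is `∞` when no `l` is admissible. -/
def luxemburgAvg {n : ℕ} (B : ℝ → ℝ) (g : (Fin n → ℝ) → ℝ≥0∞) (Q : Set (Fin n → ℝ)) : ℝ≥0∞ :=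
  ⨅ (l : ℝ≥0) (_ : 0 < l) (_ : ⨍⁻ x in Q, youngExt B (g x / l) ∂volume ≤ 1), (l : ℝ≥0∞)

/-- The closed cube with sides of length `l` parallel to the axes and lowest vertex `a`. -/
def cube {n : ℕ} (a : Fin n → ℝ) (l : ℝ) : Set (Fin n → ℝ) := Icc a (fun j => a j + l)

/-- The multilinear fractional maximal operator `M_{α,B}`: the supremum, over all nondegenerate
cubes `Q` containing `x`, of `|Q|^(α/n) ∏ i, ‖f i‖_{B,Q}`. -/
def fracMaximal {n m : ℕ} {𝕜 : Type*} [RCLike 𝕜] (α : ℝ) (B : ℝ → ℝ)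
    (f : Fin m → (Fin n → ℝ) → 𝕜) (x : Fin n → ℝ) : ℝ≥0∞ :=
  ⨆ (a : Fin n → ℝ) (l : ℝ) (_ : 0 < l) (_ : x ∈ cube a l),
    volume (cube a l) ^ (α / n) * ∏ i, luxemburgAvg B (fun y => ‖f i y‖ₑ) (cube a l)

/-- The supremum, over all nondegenerate cubes `Q`, of
`|Q|^(α/n + 1/q - 1/p) (⨍_Q ν^q)^(1/q) ∏ i, ‖(w i)⁻¹‖_{A i,Q}`. The reciprocal is taken in
`[0, ∞]`, so it is `∞` where the weight vanishes. -/
def bumpConstant {n m : ℕ} (α p q : ℝ) (A : Fin m → ℝ → ℝ) (ν : (Fin n → ℝ) → ℝ≥0)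
    (w : Fin m → (Fin n → ℝ) → ℝ≥0) : ℝ≥0∞ :=
  ⨆ (a : Fin n → ℝ) (l : ℝ) (_ : 0 < l),
    volume (cube a l) ^ (α / n + 1 / q - 1 / p) *
      (⨍⁻ x in cube a l, (ν x : ℝ≥0∞) ^ q ∂volume) ^ (1 / q) *
      ∏ i, luxemburgAvg (A i) (fun x => (w i x : ℝ≥0∞)⁻¹) (cube a l)

end

/-! The one-third trick puts every cube inside a cell of comparable size of one of `2 ^ n` shifted
dyadic grids (`exists_cube_subset_gridCell`). By `fracMaximal_le` it is therefore enough to bound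
the dyadic maximal functions, uniformly in the largest scale `2 ^ N`, and to let `N → ∞`.

Write `a_Q = |Q|^(α/n) ∏ ‖f_i‖_{B,Q}`. Call a cell principal if `a_Q` exceeds `(4m)^m` times its
value on every larger principal cell. At each point the dyadic maximal function is at most `(4m)^m`
times the supremum of `a_Q` over principal cells. A weak-type bound for each Luxemburg average shows
that the smaller principal cells cover at most half of a principal `Q` (`isSparse_fracAvg`). This
leaves disjoint sets `E_Q ⊆ Q` with `|Q| ≤ 2|E_Q|`.

On one cell, Hölder's inequality gives `‖f_i‖_{B,Q} ≤ 4 ‖w_i⁻¹‖_{A_i,Q} ‖f_i w_i‖_{C_i,Q}`, and the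
bump condition then yields `a_Q^q ∫_Q ν^q ≤ K (|Q| ∏ ‖f_i w_i‖_{C_i,Q}^p)^(q/p)`
(`fracAvg_rpow_mul_lintegral_le`). As `q/p ≥ 1`, the sum over principal cells may be taken inside
the power. Replacing `|Q|` by `2|E_Q|` bounds it by an integral of `sup_Q ∏ ‖f_i w_i‖_{C_i,Q}^p`.
Hölder's inequality with exponents `P i / p` reduces this to the `L^(P i)` bound for the maximal
operator of `C_i`, which is what the `B_{p_i}` condition provides
(`exists_lintegral_luxemburgAvg_rpow_le`). -/

/-! ### Young functions and their inverses -/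

namespace IsYoungFunction

variable {B : ℝ → ℝ}

lemma map_zero (hB : IsYoungFunction B) : B 0 = 0 := by
  obtain ⟨b, -, -, -, h⟩ := hB
  simp [h 0 le_rfl]

lemma monotoneOn (hB : IsYoungFunction B) : MonotoneOn B (Ici 0) := by
  obtain ⟨b, hm, hn, -, h⟩ := hB
  intro s hs t ht hst
  have hi : ∀ {u v : ℝ}, 0 ≤ u → 0 ≤ v → IntervalIntegrable b volume u v := fun hu hv =>
    (hm.mono ((convex_Ici (0 : ℝ)).ordConnected.uIcc_subset hu hv)).intervalIntegrable
  rw [h s hs, h t ht, ← intervalIntegral.integral_add_adjacent_intervals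
    (hi le_rfl hs) (hi hs ht)]
  have : 0 ≤ ∫ x in s..t, b x :=
    intervalIntegral.integral_nonneg hst fun u hu => hn u (le_trans hs hu.1)
  linarith

lemma nonneg (hB : IsYoungFunction B) {t : ℝ} (ht : 0 ≤ t) : 0 ≤ B t := by
  rw [← hB.map_zero]
  exact hB.monotoneOn self_mem_Ici ht ht

/-- After rescaling, `R * B (t / R)` is the integral of `b (x / R) ≤ b x` over `[0, t]`. This
consequence of convexity stands in for convexity throughout. -/
lemma map_div_le (hB : IsYoungFunction B) {t R : ℝ} (ht : 0 ≤ t) (hR : 1 ≤ R) :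
    B (t / R) ≤ B t / R := by
  obtain ⟨b, hm, hn, -, h⟩ := hB
  have hR0 : 0 < R := by linarith
  rw [h t ht, h _ (by positivity)]
  have hi : IntervalIntegrable b volume 0 t :=
    (hm.mono ((convex_Ici (0 : ℝ)).ordConnected.uIcc_subset self_mem_Ici ht)).intervalIntegrable
  have hsub : ∀ x ∈ Icc 0 t, x / R ≤ x := fun x hx => div_le_self hx.1 hR
  have hm' : MonotoneOn (fun x => b (x / R)) (Ici 0) := fun x hx y hy hxy =>
    hm (div_nonneg hx hR0.le) (div_nonneg hy hR0.le) (by gcongr)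
  have hi' : IntervalIntegrable (fun x => b (x / R)) volume 0 t :=
    (hm'.mono ((convex_Ici (0 : ℝ)).ordConnected.uIcc_subset self_mem_Ici ht)).intervalIntegrable
  have h1 : ∫ x in (0 : ℝ)..t, b (x / R) = R * ∫ x in (0 : ℝ)..(t / R), b x := by
    rw [intervalIntegral.integral_comp_div _ hR0.ne']
    simp
  have h2 : ∫ x in (0 : ℝ)..t, b (x / R) ≤ ∫ x in (0 : ℝ)..t, b x :=
    intervalIntegral.integral_mono_on ht hi' hi fun x hx =>
      hm (div_nonneg hx.1 hR0.le) hx.1 (hsub x hx)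
  rw [le_div_iff₀ hR0]
  linarith

lemma exists_pos (hB : IsYoungFunction B) : ∃ t, 0 < t ∧ 0 < B t := by
  obtain ⟨b, hm, hn, ⟨s, hs, hbs⟩, h⟩ := hB
  refine ⟨s + 1, by linarith, ?_⟩
  have hi : ∀ {u v : ℝ}, 0 ≤ u → 0 ≤ v → IntervalIntegrable b volume u v := fun hu hv =>
    (hm.mono ((convex_Ici (0 : ℝ)).ordConnected.uIcc_subset hu hv)).intervalIntegrable
  have hs1 : 0 ≤ s + 1 := by linarith
  rw [h _ hs1, ← intervalIntegral.integral_add_adjacent_intervals (hi le_rfl hs) (hi hs hs1)]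
  have h0 : 0 ≤ ∫ x in (0 : ℝ)..s, b x :=
    intervalIntegral.integral_nonneg hs fun u hu => hn u hu.1
  have h1 : ∫ _ in s..(s + 1), b s ≤ ∫ x in s..(s + 1), b x :=
    intervalIntegral.integral_mono_on (by linarith) intervalIntegrable_const (hi hs hs1)
      fun x hx => hm hs (le_trans hs hx.1) hx.1
  have h2 : 0 < b s := lt_of_le_of_ne (hn s hs) hbs.symm
  simp at h1
  linarith

lemma exists_lt (hB : IsYoungFunction B) (u : ℝ) : ∃ t, 0 < t ∧ u < B t := by
  obtain ⟨t, ht, hBt⟩ := hB.exists_pos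
  set R := max 1 (u / B t + 1)
  have hR : 1 ≤ R := le_max_left _ _
  refine ⟨R * t, by positivity, ?_⟩
  have h1 := hB.map_div_le (t := R * t) (by positivity) hR
  rw [mul_div_cancel_left₀ t (by positivity), le_div_iff₀ (by positivity)] at h1
  have h2 : u / B t + 1 ≤ R := le_max_right _ _
  have h3 : u < B t * R := by
    rw [← div_lt_iff₀' hBt]
    linarith
  linarith

lemma exists_le (hB : IsYoungFunction B) {ε : ℝ} (hε : 0 < ε) : ∃ t, 0 < t ∧ B t ≤ ε := by
  have h1 : 0 ≤ B 1 := hB.nonneg zero_le_one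
  set R := max 1 (B 1 / ε)
  have hR : 1 ≤ R := le_max_left _ _
  refine ⟨1 / R, by positivity, (hB.map_div_le zero_le_one hR).trans ?_⟩
  rw [div_le_iff₀ (by positivity), ← div_le_iff₀' hε]
  exact le_max_right _ _

lemma le_youngInv (hB : IsYoungFunction B) {s u : ℝ} (hu : B s ≤ u) :
    s ≤ youngInv B u := by
  obtain ⟨t, ht, hBt⟩ := hB.exists_lt u
  refine le_csInf ⟨t, ht.le, hBt⟩ fun r hr => ?_
  by_contra! hlt
  exact absurd (hB.monotoneOn hr.1 (hr.1.trans hlt.le) hlt.le) (by linarith [hr.2])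

lemma le_of_lt_youngInv {s u : ℝ} (hs : 0 ≤ s) (h : s < youngInv B u) : B s ≤ u := by
  by_contra! hlt
  exact absurd (csInf_le ⟨0, fun r hr => hr.1⟩ (show s ∈ {s | 0 ≤ s ∧ u < B s} from ⟨hs, hlt⟩))
    (not_le.2 h)

/-- Young's inequality for three Young functions whose inverses satisfy `A⁻¹ C⁻¹ ≤ B⁻¹`. -/
lemma map_mul_div_two_le {A C : ℝ → ℝ} (hB : IsYoungFunction B) (hA : IsYoungFunction A)
    (hC : IsYoungFunction C)
    (h : ∀ t, 0 < t → youngInv A t * youngInv C t ≤ youngInv B t) {s t : ℝ} (hs : 0 ≤ s)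
    (ht : 0 ≤ t) : B (s * t / 2) ≤ A s + C t := by
  have hAs := hA.nonneg hs
  have hCt := hC.nonneg ht
  rcases (mul_nonneg hs ht).eq_or_lt with h0 | hpos
  · rw [← h0, zero_div, hB.map_zero]
    positivity
  -- Halving makes `s * t / 2` strictly smaller than `youngInv B u`, so `B (s * t / 2) ≤ u` follows
  -- without continuity of `B`; `ε` makes `u` positive.
  refine le_of_forall_pos_le_add fun ε hε => le_of_lt_youngInv (by positivity) ?_
  have hu : 0 < A s + C t + ε := by positivity
  calc s * t / 2 < s * t := by linarith
    _ ≤ youngInv A (A s + C t + ε) * youngInv C (A s + C t + ε) := by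
        have h1 := hA.le_youngInv (s := s) (u := A s + C t + ε) (by linarith)
        have h2 := hC.le_youngInv (s := t) (u := A s + C t + ε) (by linarith)
        exact mul_le_mul h1 h2 ht (hs.trans h1)
    _ ≤ _ := h _ hu

lemma monotone_youngExt (hB : IsYoungFunction B) : Monotone (youngExt B) := by
  intro x y hxy
  unfold youngExt
  split_ifs with h1 h2 h2
  · exact le_rfl
  · exact absurd (top_le_iff.1 (h1 ▸ hxy)) h2
  · exact le_top
  · exact ENNReal.ofReal_le_ofReal (hB.monotoneOn ENNReal.toReal_nonneg ENNReal.toReal_nonneg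
      (ENNReal.toReal_mono h2 hxy))

lemma measurable_youngExt (hB : IsYoungFunction B) : Measurable (youngExt B) :=
  hB.monotone_youngExt.measurable

lemma youngExt_div_le (hB : IsYoungFunction B) (x : ℝ≥0∞) {R : ℝ≥0} (hR : 1 ≤ R) :
    youngExt B (x / R) ≤ youngExt B x / R := by
  have hR0 : (R : ℝ≥0∞) ≠ 0 := by
    simpa using (zero_lt_one.trans_le hR).ne'
  unfold youngExt
  by_cases hx : x = ⊤
  · simp [hx, ENNReal.top_div]
  · have h1 : x / R ≠ ⊤ := ENNReal.div_ne_top hx hR0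
    have h2 : (0 : ℝ) < R := by exact_mod_cast zero_lt_one.trans_le hR
    rw [if_neg hx, if_neg h1, ENNReal.toReal_div, ENNReal.coe_toReal,
      ← ENNReal.ofReal_coe_nnreal (p := R), ← ENNReal.ofReal_div_of_pos h2]
    exact ENNReal.ofReal_le_ofReal (hB.map_div_le ENNReal.toReal_nonneg (by exact_mod_cast hR))

lemma youngExt_mul_div_two_le {A C : ℝ → ℝ} (hB : IsYoungFunction B) (hA : IsYoungFunction A)
    (hC : IsYoungFunction C)
    (h : ∀ t, 0 < t → youngInv A t * youngInv C t ≤ youngInv B t) {x y : ℝ≥0∞}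
    (hx : x ≠ ⊤) (hy : y ≠ ⊤) :
    youngExt B (x * y / 2) ≤ youngExt A x + youngExt C y := by
  have h1 : x * y / 2 ≠ ⊤ := ENNReal.div_ne_top (ENNReal.mul_ne_top hx hy) two_ne_zero
  unfold youngExt
  rw [if_neg hx, if_neg hy, if_neg h1, ← ENNReal.ofReal_add (hA.nonneg ENNReal.toReal_nonneg)
    (hC.nonneg ENNReal.toReal_nonneg), ENNReal.toReal_div, ENNReal.toReal_mul]
  exact ENNReal.ofReal_le_ofReal
    (hB.map_mul_div_two_le hA hC h ENNReal.toReal_nonneg ENNReal.toReal_nonneg)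

end IsYoungFunction

/-! ### Luxemburg averages -/

section luxemburg

variable {n : ℕ} {B : ℝ → ℝ} {g : (Fin n → ℝ) → ℝ≥0∞} {Q P : Set (Fin n → ℝ)}

lemma luxemburgAvg_congr_set (h : Q =ᵐ[volume] P) : luxemburgAvg B g Q = luxemburgAvg B g P := by
  simp only [luxemburgAvg, setLAverage_congr h]

lemma luxemburgAvg_congr_fun {g' : (Fin n → ℝ) → ℝ≥0∞} (h : g =ᵐ[volume] g') :
    luxemburgAvg B g Q = luxemburgAvg B g' Q := by
  have : ∀ l : ℝ≥0, ⨍⁻ x in Q, youngExt B (g x / l) ∂volume =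
      ⨍⁻ x in Q, youngExt B (g' x / l) ∂volume := fun l =>
    laverage_congr (ae_restrict_of_ae (h.mono fun x hx => by simp only [hx]))
  simp only [luxemburgAvg, this]

lemma luxemburgAvg_le {l : ℝ≥0} (hl : 0 < l)
    (h : ⨍⁻ x in Q, youngExt B (g x / l) ∂volume ≤ 1) : luxemburgAvg B g Q ≤ l :=
  iInf₂_le_of_le l hl (iInf_le _ h)

lemma one_lt_laverage_of_lt_luxemburgAvg {l : ℝ≥0} (hl : 0 < l) (h : l < luxemburgAvg B g Q) :
    1 < ⨍⁻ x in Q, youngExt B (g x / l) ∂volume := by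
  by_contra! h'
  exact absurd (luxemburgAvg_le hl h') (not_le.2 h)

lemma exists_of_luxemburgAvg_lt {c : ℝ≥0∞} (h : luxemburgAvg B g Q < c) :
    ∃ l : ℝ≥0, 0 < l ∧ (l : ℝ≥0∞) < c ∧ ⨍⁻ x in Q, youngExt B (g x / l) ∂volume ≤ 1 := by
  simp only [luxemburgAvg, iInf_lt_iff] at h
  obtain ⟨l, hl, h1, h2⟩ := h
  exact ⟨l, hl, h2, h1⟩

lemma measure_le_lintegral_of_lt_luxemburgAvg {l : ℝ≥0} (hl : 0 < l)
    (hQ : volume Q ≠ ⊤) (h : l < luxemburgAvg B g Q) :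
    volume Q ≤ ∫⁻ x in Q, youngExt B (g x / l) := by
  rcases eq_or_ne (volume Q) 0 with h0 | h0
  · simp [h0]
  have h1 := one_lt_laverage_of_lt_luxemburgAvg hl h
  rw [setLAverage_eq, ENNReal.lt_div_iff_mul_lt (.inl h0) (.inl hQ), one_mul] at h1
  exact h1.le

/-- If `l` is admissible on `P`, then `l * D` is admissible on `Q`: by `map_div_le` the extra `D`
divides the integral, which offsets the loss of volume. -/
lemma luxemburgAvg_le_mul (hB : IsYoungFunction B) (hQP : Q ⊆ P) {D : ℝ≥0} (hD : 1 ≤ D)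
    (hPQ : volume P ≤ D * volume Q) (hQ0 : volume Q ≠ 0) (hP : volume P ≠ ⊤) :
    luxemburgAvg B g Q ≤ D * luxemburgAvg B g P := by
  have hD0 : 0 < D := zero_lt_one.trans_le hD
  have hDe : (D : ℝ≥0∞) ≠ 0 := by simpa using hD0.ne'
  have hP0 : volume P ≠ 0 := fun h => hQ0 (measure_mono_null hQP h)
  rw [mul_comm, ← ENNReal.div_le_iff hDe ENNReal.coe_ne_top]
  refine le_iInf₂ fun l hl => le_iInf fun h => ?_
  rw [ENNReal.div_le_iff hDe ENNReal.coe_ne_top, ← ENNReal.coe_mul]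
  refine luxemburgAvg_le (mul_pos hl hD0) ?_
  rw [setLAverage_eq] at h ⊢
  have hPle : ∫⁻ x in P, youngExt B (g x / l) ≤ volume P := by
    rwa [ENNReal.div_le_iff hP0 hP, one_mul] at h
  refine ENNReal.div_le_of_le_mul ?_
  rw [one_mul]
  calc ∫⁻ x in Q, youngExt B (g x / ↑(l * D))
      ≤ ∫⁻ x in Q, youngExt B (g x / l) / D := by
        refine lintegral_mono fun x => ?_
        have : g x / ↑(l * D) = g x / l / D := by
          rw [ENNReal.coe_mul, div_eq_mul_inv, ENNReal.mul_inv (.inr (by simp)) (.inl (by simp)),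
            ← mul_assoc, ← div_eq_mul_inv, ← div_eq_mul_inv]
        rw [this]
        exact hB.youngExt_div_le _ hD
    _ ≤ ∫⁻ x in P, youngExt B (g x / l) / D := lintegral_mono_set hQP
    _ = (∫⁻ x in P, youngExt B (g x / l)) / D := by
        simp_rw [div_eq_mul_inv]
        exact lintegral_mul_const' _ _ (by simpa using hD0.ne')
    _ ≤ volume Q := by
        refine ENNReal.div_le_of_le_mul' (hPle.trans hPQ)

/-- A positive `g` is at least some `ε` on a subset of measure `δ > 0`, so admissible `l` cannot be
too small because `B` is unbounded. Used for `w⁻¹`, which is positive since weights are finite. -/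
lemma luxemburgAvg_ne_zero (hB : IsYoungFunction B) (hg : AEMeasurable g) (h0 : ∀ x, g x ≠ 0)
    (hQ0 : volume Q ≠ 0) (hQ : volume Q ≠ ⊤) :
    luxemburgAvg B g Q ≠ 0 := by
  intro hz
  have hint : ∫⁻ x in Q, min (g x) 1 ≠ 0 := by
    intro h
    rw [lintegral_eq_zero_iff' (by fun_prop)] at h
    have h2 : ∀ᵐ x ∂(volume.restrict Q), False := by
      filter_upwards [h] with x hx
      simp only [Pi.zero_apply] at hx
      rcases min_eq_iff.1 hx with h' | h'
      · exact h0 x h'.1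
      · simp at h'
    simp [ae_iff, hQ0] at h2
  obtain ⟨ε, hε, hε0⟩ : ∃ ε : ℝ≥0, 0 < ε ∧ volume (Q ∩ {x | (ε : ℝ≥0∞) ≤ g x}) ≠ 0 := by
    by_contra! hcon
    have : volume (⋃ k : ℕ, Q ∩ {x | (((k : ℝ≥0) + 1)⁻¹ : ℝ≥0) ≤ g x}) = 0 :=
      measure_iUnion_null fun k => hcon _ (by positivity)
    refine hQ0 (measure_mono_null (fun x hx => ?_) this)
    obtain ⟨k, hk⟩ := ENNReal.exists_inv_nat_lt (h0 x)
    refine mem_iUnion.2 ⟨k, hx, ?_⟩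
    simp only [mem_ofPred_eq]
    refine le_trans ?_ hk.le
    rw [ENNReal.coe_inv (by positivity), ENNReal.inv_le_inv]
    push_cast
    exact le_self_add
  set δ := volume (Q ∩ {x | (ε : ℝ≥0∞) ≤ g x}) with hδ
  have hδt : δ ≠ ⊤ := ne_top_of_le_ne_top hQ (measure_mono inter_subset_left)
  -- With `B t > |Q| / δ` and an admissible `l < ε / t`, one has `g / l ≥ t` where `g ≥ ε`, so `B t
  -- * δ ≤ |Q|`, a contradiction.
  obtain ⟨t, ht, hBt⟩ := hB.exists_lt (volume Q / δ).toReal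
  lift t to ℝ≥0 using ht.le
  have ht' : 0 < t := by exact_mod_cast ht
  obtain ⟨l, hl, hlt, hav⟩ := exists_of_luxemburgAvg_lt
    (B := B) (g := g) (Q := Q) (c := (ε / t : ℝ≥0)) (by rw [hz]; simpa using by positivity)
  rw [setLAverage_eq, ENNReal.div_le_iff hQ0 hQ, one_mul] at hav
  have hl' : l < ε / t := by exact_mod_cast hlt
  have key : youngExt B t * δ ≤ volume Q := by
    refine le_trans ?_ hav
    calc youngExt B t * δ = ∫⁻ x in Q ∩ {x | (ε : ℝ≥0∞) ≤ g x}, youngExt B t := by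
          rw [setLIntegral_const]
      _ ≤ ∫⁻ x in Q ∩ {x | (ε : ℝ≥0∞) ≤ g x}, youngExt B (g x / l) := by
          refine setLIntegral_mono_ae ?_ ?_
          · exact (hB.measurable_youngExt.comp_aemeasurable (by fun_prop)).restrict
          · refine .of_forall fun x hx => hB.monotone_youngExt ?_
            rw [ENNReal.le_div_iff_mul_le (.inl (by simpa using hl.ne')) (.inl (by simp))]
            refine le_trans ?_ hx.2
            norm_cast
            rw [lt_div_iff₀ ht'] at hl'
            rw [mul_comm]
            exact hl'.le
      _ ≤ ∫⁻ x in Q, youngExt B (g x / l) := lintegral_mono_set inter_subset_left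
  rw [← ENNReal.le_div_iff_mul_le (.inl hε0) (.inl hδt)] at key
  simp only [youngExt, ENNReal.coe_ne_top, if_false, ENNReal.coe_toReal] at key
  rw [ENNReal.ofReal_le_iff_le_toReal (ENNReal.div_ne_top hQ hε0)] at key
  linarith

/-- The generalized Hölder inequality for Luxemburg averages. -/
lemma luxemburgAvg_le_mul_luxemburgAvg {A C : ℝ → ℝ} (hB : IsYoungFunction B)
    (hA : IsYoungFunction A) (hC : IsYoungFunction C)
    (h : ∀ t, 0 < t → youngInv A t * youngInv C t ≤ youngInv B t)
    {f w : (Fin n → ℝ) → ℝ≥0} (hw : AEMeasurable w)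
    (hA0 : luxemburgAvg A (fun x => (w x : ℝ≥0∞)⁻¹) Q ≠ 0)
    (hAt : luxemburgAvg A (fun x => (w x : ℝ≥0∞)⁻¹) Q ≠ ⊤)
    (hQ0 : volume Q ≠ 0) (hQ : volume Q ≠ ⊤) :
    luxemburgAvg B (fun x => (f x : ℝ≥0∞)) Q ≤
      4 * (luxemburgAvg A (fun x => (w x : ℝ≥0∞)⁻¹) Q *
        luxemburgAvg C (fun x => (f x : ℝ≥0∞) * w x) Q) := by
  rw [mul_comm, ← ENNReal.div_le_iff (by norm_num) (by norm_num)]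
  -- The constant 4 is 2 from the three-function Young inequality times 2 from adding two averages
  -- that are each at most 1.
  refine ENNReal.le_mul_of_forall_lt (.inl hA0) (.inl hAt) fun a ha c hc => ?_
  obtain ⟨k, hk, hka, hk1⟩ := exists_of_luxemburgAvg_lt ha
  obtain ⟨l, hl, hlc, hl1⟩ := exists_of_luxemburgAvg_lt hc
  refine le_trans ?_ (mul_le_mul' hka.le hlc.le)
  rw [ENNReal.div_le_iff (by norm_num) (by norm_num)]
  have : (k * l * 4 : ℝ≥0∞) = (k * l * 4 : ℝ≥0) := by push_cast; rfl
  rw [this]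
  refine luxemburgAvg_le (by positivity) ?_
  rw [setLAverage_eq, ENNReal.div_le_iff hQ0 hQ, one_mul] at hk1 hl1 ⊢
  have hpt : ∀ x, youngExt B ((f x : ℝ≥0∞) / (k * l * 4 : ℝ≥0)) ≤
      (youngExt A ((w x : ℝ≥0∞)⁻¹ / k) + youngExt C ((f x : ℝ≥0∞) * w x / l)) / 2 := by
    intro x
    -- Where the weight vanishes its reciprocal is `⊤`, so the right-hand side is `⊤`.
    by_cases hwx : w x = 0
    · have : youngExt A ((w x : ℝ≥0∞)⁻¹ / k) = ⊤ := by
        simp [hwx, youngExt, ENNReal.top_div]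
      simp [this, ENNReal.top_div]
    · have e1 : (w x : ℝ≥0∞)⁻¹ / k = ((w x)⁻¹ / k : ℝ≥0) := by
        rw [ENNReal.coe_div hk.ne', ENNReal.coe_inv hwx]
      have e2 : (f x : ℝ≥0∞) * w x / l = (f x * w x / l : ℝ≥0) := by
        rw [ENNReal.coe_div hl.ne', ENNReal.coe_mul]
      have e3 : (f x : ℝ≥0∞) / (k * l * 4 : ℝ≥0) =
          (((w x)⁻¹ / k : ℝ≥0) * (f x * w x / l : ℝ≥0) / 2 : ℝ≥0∞) / (2 : ℝ≥0) := by
        rw [← ENNReal.coe_div (by positivity), ← ENNReal.coe_mul, ← ENNReal.coe_ofNat,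
          ← ENNReal.coe_div (by norm_num), ← ENNReal.coe_div (by norm_num)]
        congr 1
        field_simp
        norm_num
      rw [e1, e2, e3]
      refine (hB.youngExt_div_le _ (by norm_num)).trans ?_
      exact ENNReal.div_le_div_right (hB.youngExt_mul_div_two_le hA hC h (by simp) (by simp)) _
  calc ∫⁻ x in Q, youngExt B ((f x : ℝ≥0∞) / (k * l * 4 : ℝ≥0))
      ≤ ∫⁻ x in Q, (youngExt A ((w x : ℝ≥0∞)⁻¹ / k) + youngExt C ((f x : ℝ≥0∞) * w x / l)) / 2 :=
        lintegral_mono hpt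
    _ = ((∫⁻ x in Q, youngExt A ((w x : ℝ≥0∞)⁻¹ / k)) +
          ∫⁻ x in Q, youngExt C ((f x : ℝ≥0∞) * w x / l)) / 2 := by
        simp_rw [div_eq_mul_inv _ (2 : ℝ≥0∞)]
        rw [lintegral_mul_const' _ _ (by simp), lintegral_add_left']
        exact (hA.measurable_youngExt.comp_aemeasurable (by fun_prop)).restrict
    _ ≤ (volume Q + volume Q) / 2 := ENNReal.div_le_div_right (add_le_add hk1 hl1) _
    _ = volume Q := by
        rw [← two_mul, mul_comm, ENNReal.mul_div_cancel_right two_ne_zero (by norm_num)]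

end luxemburg

/-! ### Nested partitions and principal cells -/

/-- Split `f i ^ s = f i * f i ^ (s - 1)` and bound the second factor by the same power of the whole
sum. This is where `p ≤ q` enters, with `s = q / p`. -/
lemma ENNReal.tsum_rpow_le_rpow_tsum {ι : Type*} (f : ι → ℝ≥0∞) {s : ℝ} (hs : 1 ≤ s) :
    ∑' i, f i ^ s ≤ (∑' i, f i) ^ s := by
  have h : ∀ x : ℝ≥0∞, x ^ s = x * x ^ (s - 1) := fun x => by
    conv_lhs => rw [show s = 1 + (s - 1) by ring,
      ENNReal.rpow_add_of_nonneg _ _ zero_le_one (by linarith), ENNReal.rpow_one]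
  simp_rw [h]
  rw [← ENNReal.tsum_mul_right]
  refine ENNReal.tsum_le_tsum fun i => ?_
  have : 0 ≤ s - 1 := by linarith
  gcongr
  exact ENNReal.le_tsum i

/-- A sequence of countable measurable partitions of `X`, each refining the previous one. The cell
of level `k` containing `x` is labelled `idx k x`. -/
structure NestedPartition (X J : Type*) [MeasurableSpace X] where
  /-- The label of the cell of level `k` containing a given point. -/
  idx : ℕ → X → J
  measurableSet_preimage : ∀ k j, MeasurableSet (idx k ⁻¹' {j})
  nested : ∀ k x y, idx (k + 1) x = idx (k + 1) y → idx k x = idx k y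

namespace NestedPartition

variable {X J : Type*} [MeasurableSpace X] (𝓟 : NestedPartition X J)

/-- The cell of level `k` with label `j`. -/
def cell (k : ℕ) (j : J) : Set X := 𝓟.idx k ⁻¹' {j}

lemma measurableSet_cell (k : ℕ) (j : J) : MeasurableSet (𝓟.cell k j) :=
  𝓟.measurableSet_preimage k j

lemma idx_eq_of_le {k l : ℕ} (hkl : k ≤ l) {x y : X} (h : 𝓟.idx l x = 𝓟.idx l y) :
    𝓟.idx k x = 𝓟.idx k y := by
  induction l, hkl using Nat.le_induction with
  | base => exact h
  | succ l _ ih => exact ih (𝓟.nested l x y h)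

lemma cell_subset_cell {k l : ℕ} (hkl : k ≤ l) (x : X) :
    𝓟.cell l (𝓟.idx l x) ⊆ 𝓟.cell k (𝓟.idx k x) :=
  fun _ hy => 𝓟.idx_eq_of_le hkl hy

/-- The cell of level `k` containing `x` is principal for `a` with ratio `R` if the value of `a`
there exceeds `R` times its value at every larger principal cell containing `x`. -/
def IsPrincipal (a : ℕ → J → ℝ≥0∞) (R : ℝ≥0∞) (k : ℕ) (x : X) : Prop :=
  ∀ k', ∀ _ : k' < k, IsPrincipal a R k' x → R * a k' (𝓟.idx k' x) < a k (𝓟.idx k x)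

variable {a : ℕ → J → ℝ≥0∞} {R : ℝ≥0∞}

lemma isPrincipal_iff {k : ℕ} {x : X} : 𝓟.IsPrincipal a R k x ↔
    ∀ k', k' < k → 𝓟.IsPrincipal a R k' x → R * a k' (𝓟.idx k' x) < a k (𝓟.idx k x) := by
  rw [IsPrincipal]

lemma isPrincipal_of_idx_eq {k : ℕ} {x y : X} (h : 𝓟.idx k x = 𝓟.idx k y)
    (hx : 𝓟.IsPrincipal a R k x) : 𝓟.IsPrincipal a R k y := by
  induction k using Nat.strong_induction_on generalizing x y with
  | _ k ih =>
    rw [isPrincipal_iff] at hx ⊢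
    intro k' hk' hy
    have hk := 𝓟.idx_eq_of_le hk'.le h
    rw [← h, ← hk]
    exact hx k' hk' (ih k' hk' hk.symm hy)

/-- A cell that fails to be principal does so because of a larger principal cell, and that cell is
the witness. -/
lemma exists_isPrincipal (hR : 1 ≤ R) (k : ℕ) (x : X) :
    ∃ k', 𝓟.IsPrincipal a R k' x ∧ a k (𝓟.idx k x) ≤ R * a k' (𝓟.idx k' x) := by
  by_cases h : 𝓟.IsPrincipal a R k x
  · exact ⟨k, h, le_mul_of_one_le_left zero_le hR⟩
  · rw [isPrincipal_iff] at h
    push Not at h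
    obtain ⟨k', -, h1, h2⟩ := h
    exact ⟨k', h1, h2⟩

/-- The principal part of a cell: the whole cell if it is principal, and empty otherwise. -/
def principalCell (a : ℕ → J → ℝ≥0∞) (R : ℝ≥0∞) (i : ℕ × J) : Set X :=
  {x | 𝓟.idx i.1 x = i.2 ∧ 𝓟.IsPrincipal a R i.1 x}

lemma principalCell_eq {i : ℕ × J} {x : X} (hx : x ∈ 𝓟.principalCell a R i) :
    𝓟.principalCell a R i = 𝓟.cell i.1 (𝓟.idx i.1 x) := by
  ext y
  rw [hx.1]
  exact ⟨fun hy => hy.1, fun hy => ⟨hy, 𝓟.isPrincipal_of_idx_eq (hx.1.trans (Eq.symm hy)) hx.2⟩⟩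

/-- The points of a principal cell lying in no smaller principal cell. -/
def principalRest (a : ℕ → J → ℝ≥0∞) (R : ℝ≥0∞) (i : ℕ × J) : Set X :=
  𝓟.principalCell a R i \ ⋃ k > i.1, {x | 𝓟.IsPrincipal a R k x}

lemma pairwise_disjoint_principalRest :
    Pairwise (Function.onFun Disjoint (𝓟.principalRest a R)) := by
  rintro ⟨k, j⟩ ⟨k', j'⟩ hne
  refine disjoint_left.2 ?_
  rintro x ⟨⟨h1, h2⟩, h3⟩ ⟨⟨h1', h2'⟩, h3'⟩
  obtain rfl : 𝓟.idx k x = j := h1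
  obtain rfl : 𝓟.idx k' x = j' := h1'
  simp only [mem_iUnion, mem_ofPred_eq, not_exists] at h3 h3'
  rcases lt_trichotomy k k' with hlt | rfl | hlt
  · exact h3 k' hlt h2'
  · exact hne rfl
  · exact h3' k hlt h2

lemma measurableSet_principalCell (i : ℕ × J) : MeasurableSet (𝓟.principalCell a R i) := by
  rcases (𝓟.principalCell a R i).eq_empty_or_nonempty with h0 | ⟨x, hx⟩
  · simp [h0]
  · rw [𝓟.principalCell_eq hx]
    exact 𝓟.measurableSet_cell _ _

/-- The values of `a` are sparse if, for every cell, at most half of it is covered by smaller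
cells on which `a` is larger by the factor `R`. -/
def IsSparse (μ : Measure X) (a : ℕ → J → ℝ≥0∞) (R : ℝ≥0∞) : Prop :=
  ∀ k x, 2 * μ {y ∈ 𝓟.cell k (𝓟.idx k x) | ∃ k' > k,
    R * a k (𝓟.idx k x) < a k' (𝓟.idx k' y)} ≤ μ (𝓟.cell k (𝓟.idx k x))

/-- Passing to a smaller principal cell raises `a` by more than the factor `R`, so the points
removed lie in the set that sparseness limits to half the cell. Finiteness of the measure permits
the final cancellation. -/
lemma measure_principalCell_le {μ : Measure X} (ha : 𝓟.IsSparse μ a R)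
    (hfin : ∀ k x, μ (𝓟.cell k (𝓟.idx k x)) ≠ ⊤) (i : ℕ × J) :
    μ (𝓟.principalCell a R i) ≤ 2 * μ (𝓟.principalRest a R i) := by
  rcases (𝓟.principalCell a R i).eq_empty_or_nonempty with h0 | ⟨x, hx⟩
  · simp [h0]
  obtain ⟨k, j⟩ := i
  obtain ⟨h1, hp⟩ := hx
  obtain rfl : 𝓟.idx k x = j := h1
  have hx : x ∈ 𝓟.principalCell a R (k, 𝓟.idx k x) := ⟨rfl, hp⟩
  set D := {y ∈ 𝓟.cell k (𝓟.idx k x) | ∃ k' > k, R * a k (𝓟.idx k x) < a k' (𝓟.idx k' y)}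
  have hsub : 𝓟.principalCell a R (k, 𝓟.idx k x) ⊆
      𝓟.principalRest a R (k, 𝓟.idx k x) ∪ D := by
    intro y hy
    by_cases h : y ∈ ⋃ k' > k, {x | 𝓟.IsPrincipal a R k' x}
    · right
      simp only [mem_iUnion, mem_ofPred_eq] at h
      obtain ⟨k', hk', h⟩ := h
      refine ⟨hy.1, k', hk', ?_⟩
      have := (𝓟.isPrincipal_iff.1 h) k hk' hy.2
      rwa [show 𝓟.idx k y = 𝓟.idx k x from hy.1] at this
    · exact .inl ⟨hy, h⟩
  have h1 : μ (𝓟.principalCell a R (k, 𝓟.idx k x)) ≤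
      μ (𝓟.principalRest a R (k, 𝓟.idx k x)) + μ D :=
    (measure_mono hsub).trans (measure_union_le _ _)
  have h2 : 2 * μ D ≤ μ (𝓟.cell k (𝓟.idx k x)) := ha k x
  have h3 := 𝓟.principalCell_eq hx
  rw [← h3] at h2
  have h4 := hfin k x
  rw [← h3] at h4
  set M := μ (𝓟.principalCell a R (k, 𝓟.idx k x))
  have h5 : M + M ≤ 2 * μ (𝓟.principalRest a R (k, 𝓟.idx k x)) + M := by
    calc M + M = 2 * M := (two_mul M).symm
      _ ≤ 2 * (μ (𝓟.principalRest a R (k, 𝓟.idx k x)) + μ D) := by gcongr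
      _ ≤ _ := by rw [mul_add]; gcongr
  exact (ENNReal.add_le_add_iff_right h4).1 h5

variable [Countable J]

lemma measurableSet_of_idx {S : Set X} {k : ℕ}
    (h : ∀ x y, 𝓟.idx k x = 𝓟.idx k y → x ∈ S → y ∈ S) : MeasurableSet S := by
  have : S = ⋃ j ∈ {j | ∃ x ∈ S, 𝓟.idx k x = j}, 𝓟.cell k j := by
    ext y
    simp only [mem_iUnion, cell, mem_preimage, mem_singleton_iff, exists_prop, mem_ofPred_eq]
    exact ⟨fun hy => ⟨_, ⟨y, hy, rfl⟩, rfl⟩, fun ⟨j, ⟨x, hx, hj⟩, hy⟩ => h x y (hj.trans hy.symm) hx⟩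
  rw [this]
  exact MeasurableSet.biUnion (to_countable _) fun j _ => 𝓟.measurableSet_cell k j

lemma measurable_comp_idx {β : Type*} [MeasurableSpace β] (k : ℕ) (b : J → β) :
    Measurable fun x => b (𝓟.idx k x) := fun S _ =>
  𝓟.measurableSet_of_idx (k := k) fun x y h hx => by
    simpa only [mem_preimage, ← h] using hx

/-- If every cell satisfying `P` has measure at most its `h`-integral, then so has the union of
these cells. -/
lemma measure_exists_le (μ : Measure X) {P : ℕ → J → Prop} {h : X → ℝ≥0∞}
    (hP : ∀ k x, P k (𝓟.idx k x) →
      μ (𝓟.cell k (𝓟.idx k x)) ≤ ∫⁻ y in 𝓟.cell k (𝓟.idx k x), h y ∂μ) :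
    μ {x | ∃ k, P k (𝓟.idx k x)} ≤ ∫⁻ y, h y ∂μ := by
  -- Stopping at the first level where `P` holds selects the maximal cells, which are pairwise
  -- disjoint.
  let T : ℕ × J → Set X := fun i =>
    {x | 𝓟.idx i.1 x = i.2 ∧ P i.1 i.2 ∧ ∀ k' < i.1, ¬ P k' (𝓟.idx k' x)}
  have hTcell : ∀ i x, x ∈ T i → T i = 𝓟.cell i.1 (𝓟.idx i.1 x) := by
    rintro ⟨k, j⟩ x ⟨h1, h2, h3⟩
    obtain rfl : 𝓟.idx k x = j := h1
    ext y
    refine ⟨fun hy => hy.1, fun hy => ⟨hy, h2, fun k' hk' => ?_⟩⟩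
    rw [𝓟.idx_eq_of_le hk'.le hy]
    exact h3 k' hk'
  have hTm : ∀ i, MeasurableSet (T i) := fun i => by
    rcases (T i).eq_empty_or_nonempty with h0 | ⟨x, hx⟩
    · simp [h0]
    · rw [hTcell i x hx]
      exact 𝓟.measurableSet_cell _ _
  have hTd : Pairwise (Function.onFun Disjoint T) := by
    rintro ⟨k, j⟩ ⟨k', j'⟩ hne
    refine disjoint_left.2 ?_
    rintro x ⟨h1, h2, h3⟩ ⟨h1', h2', h3'⟩
    obtain rfl : 𝓟.idx k x = j := h1
    obtain rfl : 𝓟.idx k' x = j' := h1'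
    rcases lt_trichotomy k k' with hlt | rfl | hlt
    · exact h3' k hlt h2
    · exact hne rfl
    · exact h3 k' hlt h2'
  have hU : {x | ∃ k, P k (𝓟.idx k x)} ⊆ ⋃ i, T i := by
    classical
    intro x hx
    have hx' : ∃ k, P k (𝓟.idx k x) := hx
    exact mem_iUnion.2 ⟨⟨Nat.find hx', 𝓟.idx (Nat.find hx') x⟩, rfl, Nat.find_spec hx',
      fun k' hk' => Nat.find_min hx' hk'⟩
  calc μ {x | ∃ k, P k (𝓟.idx k x)} ≤ ∑' i, μ (T i) := (measure_mono hU).trans (measure_iUnion_le T)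
    _ ≤ ∑' i, ∫⁻ y in T i, h y ∂μ := by
        refine ENNReal.tsum_le_tsum fun i => ?_
        rcases (T i).eq_empty_or_nonempty with h0 | ⟨x, hx⟩
        · simp [h0]
        · rw [hTcell i x hx]
          exact hP _ _ (hx.1 ▸ hx.2.1)
    _ = ∫⁻ y in ⋃ i, T i, h y ∂μ := (lintegral_iUnion hTm hTd h).symm
    _ ≤ ∫⁻ y, h y ∂μ := setLIntegral_le_lintegral _ _

lemma measurableSet_isPrincipal (k : ℕ) : MeasurableSet {x | 𝓟.IsPrincipal a R k x} :=
  𝓟.measurableSet_of_idx (k := k) fun _ _ h hx => 𝓟.isPrincipal_of_idx_eq h hx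

lemma measurableSet_principalRest (i : ℕ × J) : MeasurableSet (𝓟.principalRest a R i) :=
  (𝓟.measurableSet_principalCell i).diff
    (.iUnion fun k => .iUnion fun _ => 𝓟.measurableSet_isPrincipal k)

/-- The sets `principalRest` are disjoint, and on each one its coefficient is a competitor in the
supremum. -/
lemma tsum_measure_principalRest_mul_le (μ : Measure X) (b : ℕ → J → ℝ≥0∞) :
    ∑' i : ℕ × J, μ (𝓟.principalRest a R i) * b i.1 i.2 ≤ ∫⁻ x, ⨆ k, b k (𝓟.idx k x) ∂μ :=
  calc ∑' i : ℕ × J, μ (𝓟.principalRest a R i) * b i.1 i.2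
      ≤ ∑' i : ℕ × J, ∫⁻ x in 𝓟.principalRest a R i, ⨆ k, b k (𝓟.idx k x) ∂μ := by
        refine ENNReal.tsum_le_tsum fun i => ?_
        rw [mul_comm, ← setLIntegral_const]
        refine setLIntegral_mono' (𝓟.measurableSet_principalRest i) fun x hx => ?_
        rw [← hx.1.1]
        exact le_iSup (fun k => b k (𝓟.idx k x)) i.1
    _ = ∫⁻ x in ⋃ i, 𝓟.principalRest a R i, ⨆ k, b k (𝓟.idx k x) ∂μ :=
        (lintegral_iUnion 𝓟.measurableSet_principalRest 𝓟.pairwise_disjoint_principalRest _).symm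
    _ ≤ _ := setLIntegral_le_lintegral _ _

/-- A two-measure estimate for the maximal function of a sparse family of coefficients. -/
theorem lintegral_iSup_rpow_le {μ σ : Measure X} {b : ℕ → J → ℝ≥0∞} {q s : ℝ} {K : ℝ≥0∞}
    (hq : 0 < q) (hs : 1 ≤ s) (hR : 1 ≤ R) (ha : 𝓟.IsSparse μ a R)
    (hfin : ∀ k x, μ (𝓟.cell k (𝓟.idx k x)) ≠ ⊤)
    (hab : ∀ k x, a k (𝓟.idx k x) ^ q * σ (𝓟.cell k (𝓟.idx k x)) ≤
      K * (μ (𝓟.cell k (𝓟.idx k x)) * b k (𝓟.idx k x)) ^ s) :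
    ∫⁻ x, (⨆ k, a k (𝓟.idx k x)) ^ q ∂σ ≤
      R ^ q * (K * (2 * ∫⁻ x, ⨆ k, b k (𝓟.idx k x) ∂μ) ^ s) := by
  -- Every value of `a` along the cells containing `x` is dominated by `R` times a principal value,
  -- which is one term of the sum.
  have hpt : ∀ x, (⨆ k, a k (𝓟.idx k x)) ^ q ≤ R ^ q * ∑' i : ℕ × J,
      (𝓟.principalCell a R i).indicator (fun _ => a i.1 i.2 ^ q) x := by
    intro x
    rw [← ENNReal.le_rpow_inv_iff hq]
    refine iSup_le fun k => ?_
    rw [ENNReal.le_rpow_inv_iff hq]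
    obtain ⟨k', h1, h2⟩ := 𝓟.exists_isPrincipal (a := a) hR k x
    calc a k (𝓟.idx k x) ^ q ≤ (R * a k' (𝓟.idx k' x)) ^ q := by gcongr
      _ = R ^ q * a k' (𝓟.idx k' x) ^ q := ENNReal.mul_rpow_of_nonneg _ _ hq.le
      _ ≤ _ := by
        gcongr
        refine le_trans (le_of_eq ?_) (ENNReal.le_tsum (k', 𝓟.idx k' x))
        rw [indicator_of_mem]
        exact ⟨rfl, h1⟩
  calc ∫⁻ x, (⨆ k, a k (𝓟.idx k x)) ^ q ∂σ
      ≤ ∫⁻ x, R ^ q * ∑' i : ℕ × J,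
          (𝓟.principalCell a R i).indicator (fun _ => a i.1 i.2 ^ q) x ∂σ := lintegral_mono hpt
    _ = R ^ q * ∑' i : ℕ × J, a i.1 i.2 ^ q * σ (𝓟.principalCell a R i) := by
        have hm : ∀ i : ℕ × J, Measurable
            ((𝓟.principalCell a R i).indicator (fun _ => a i.1 i.2 ^ q)) := fun i =>
          measurable_const.indicator (𝓟.measurableSet_principalCell i)
        rw [lintegral_const_mul _ (Measurable.tsum hm), lintegral_tsum
          fun i => (hm i).aemeasurable]
        simp_rw [lintegral_indicator_const (𝓟.measurableSet_principalCell _)]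
    _ ≤ R ^ q * ∑' i : ℕ × J, K * (2 * (μ (𝓟.principalRest a R i) * b i.1 i.2)) ^ s := by
        refine mul_le_mul_right (ENNReal.tsum_le_tsum fun i => ?_) _
        rcases (𝓟.principalCell a R i).eq_empty_or_nonempty with h0 | ⟨x, hx⟩
        · simp [h0]
        have h1 := hab i.1 x
        rw [← 𝓟.principalCell_eq hx, hx.1] at h1
        refine h1.trans ?_
        rw [← mul_assoc 2]
        gcongr
        exact 𝓟.measure_principalCell_le ha hfin i
    _ = R ^ q * (K * ∑' i : ℕ × J, (2 * (μ (𝓟.principalRest a R i) * b i.1 i.2)) ^ s) := by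
        rw [ENNReal.tsum_mul_left]
    _ ≤ R ^ q * (K * (∑' i : ℕ × J, 2 * (μ (𝓟.principalRest a R i) * b i.1 i.2)) ^ s) := by
        gcongr
        exact ENNReal.tsum_rpow_le_rpow_tsum _ hs
    _ ≤ _ := by
        rw [ENNReal.tsum_mul_left]
        gcongr
        exact 𝓟.tsum_measure_principalRest_mul_le μ b

end NestedPartition

/-! ### The `B_r` condition and the Luxemburg maximal operator -/

lemma youngExt_ofReal {B : ℝ → ℝ} {t : ℝ} (ht : 0 ≤ t) :
    youngExt B (ENNReal.ofReal t) = ENNReal.ofReal (B t) := by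
  rw [youngExt, if_neg ENNReal.ofReal_ne_top, ENNReal.toReal_ofReal ht]

/-- The layer cake formula for a single value. -/
lemma ENNReal.rpow_le_lintegral_Ioi {r : ℝ} (hr : 0 < r) (x : ℝ≥0∞) :
    x ^ r ≤ ∫⁻ t in Ioi (0 : ℝ), ENNReal.ofReal (r * t ^ (r - 1)) *
      {t | ENNReal.ofReal t < x}.indicator 1 t := by
  have hfin : ∀ y : ℝ≥0, (y : ℝ≥0∞) ≤ x → (y : ℝ≥0∞) ^ r ≤
      ∫⁻ t in Ioi (0 : ℝ), ENNReal.ofReal (r * t ^ (r - 1)) *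
      {t | ENNReal.ofReal t < x}.indicator 1 t := by
    intro y hy
    have h1 : ∫ t in (0 : ℝ)..y, r * t ^ (r - 1) = (y : ℝ) ^ r := by
      rw [intervalIntegral.integral_const_mul, integral_rpow (.inl (by linarith))]
      simp [Real.zero_rpow hr.ne']
      field_simp
    have hint : IntegrableOn (fun t : ℝ => r * t ^ (r - 1)) (Ioo 0 y) := by
      have := (intervalIntegral.intervalIntegrable_rpow' (a := 0) (b := (y : ℝ)) (r := r - 1)
        (by linarith)).const_mul r
      rw [intervalIntegrable_iff_integrableOn_Ioo_of_le y.coe_nonneg] at this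
      exact this
    calc (y : ℝ≥0∞) ^ r = ENNReal.ofReal ((y : ℝ) ^ r) := by
          rw [← ENNReal.ofReal_rpow_of_nonneg y.coe_nonneg hr.le, ENNReal.ofReal_coe_nnreal]
      _ = ∫⁻ t in Ioo 0 (y : ℝ), ENNReal.ofReal (r * t ^ (r - 1)) := by
          rw [← h1, intervalIntegral.integral_of_le y.coe_nonneg, integral_Ioc_eq_integral_Ioo,
            ofReal_integral_eq_lintegral_ofReal hint]
          filter_upwards [ae_restrict_mem measurableSet_Ioo] with t ht
          have := ht.1
          positivity
      _ ≤ ∫⁻ t in Ioo 0 (y : ℝ), ENNReal.ofReal (r * t ^ (r - 1)) *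
            {t | ENNReal.ofReal t < x}.indicator 1 t := by
          refine setLIntegral_mono' measurableSet_Ioo fun t ht => ?_
          rw [indicator_of_mem]
          · simp
          · refine lt_of_lt_of_le ?_ hy
            rw [← ENNReal.ofReal_coe_nnreal]
            exact (ENNReal.ofReal_lt_ofReal_iff (ht.1.trans ht.2)).2 ht.2
      _ ≤ _ := lintegral_mono_set Ioo_subset_Ioi_self
  -- For `x = ⊤` the integral dominates `y ^ r` for every finite `y`, so it is infinite.
  rcases eq_or_ne x ⊤ with rfl | hx
  · rw [ENNReal.top_rpow_of_pos hr, top_le_iff]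
    by_contra hne
    obtain ⟨y, hy⟩ := ENNReal.exists_nat_gt (r := (∫⁻ t in Ioi (0 : ℝ),
      ENNReal.ofReal (r * t ^ (r - 1)) * {t | ENNReal.ofReal t < ⊤}.indicator 1 t) ^ r⁻¹)
      (ENNReal.rpow_ne_top_of_nonneg (inv_nonneg.2 hr.le) hne)
    rw [ENNReal.rpow_inv_lt_iff hr] at hy
    exact absurd (hfin y le_top) (not_le.2 (by simpa using hy))
  · lift x to ℝ≥0 using hx
    exact hfin x le_rfl

/-- The lower limit is immaterial: on a compact interval away from 0 the integrand is a monotone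
function times a continuous one, hence integrable. -/
lemma SatisfiesBr.lintegral_Ioi_lt_top {C : ℝ → ℝ} {r : ℝ} (hC : IsYoungFunction C)
    (h : SatisfiesBr r C) {c : ℝ} (hc : 0 < c) :
    ∫⁻ t in Ioi c, ENNReal.ofReal (C t / t ^ r * (1 / t)) < ⊤ := by
  obtain ⟨d, hd, hint⟩ := h
  have h1 : IntegrableOn (fun t : ℝ => C t / t ^ r * (1 / t)) (Ioc c d) := by
    have hmono : IntegrableOn C (Icc c d) :=
      (hC.monotoneOn.mono fun t ht => hc.le.trans ht.1).integrableOn_isCompact isCompact_Icc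
    have hcont : ContinuousOn (fun t : ℝ => (t ^ r)⁻¹ * (1 / t)) (Icc c d) := by
      intro t ht
      have ht0 : t ≠ 0 := (hc.trans_le ht.1).ne'
      refine ContinuousAt.continuousWithinAt ?_
      have : t ^ r ≠ 0 := (Real.rpow_pos_of_pos (hc.trans_le ht.1) r).ne'
      exact ((Real.continuousAt_rpow_const t r (.inl ht0)).inv₀ this).mul
        (continuousAt_const.div continuousAt_id ht0)
    refine ((hmono.mul_continuousOn hcont isCompact_Icc).mono_set Ioc_subset_Icc_self).congr_fun
      (fun t _ => ?_) measurableSet_Ioc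
    simp only [div_eq_mul_inv]
    ring
  have h2 : IntegrableOn (fun t : ℝ => C t / t ^ r * (1 / t)) (Ioi c) :=
    (h1.union hint).mono_set fun t ht => (le_or_gt t d).imp (fun h => ⟨ht, h⟩) id
  refine (h2.lintegral_lt_top : _)

/-- The integral in `t` that arises from the layer cake formula for the maximal operator. -/
lemma SatisfiesBr.exists_lintegral_le {C : ℝ → ℝ} {r : ℝ} (hC : IsYoungFunction C) (hr : 0 < r)
    (h : SatisfiesBr r C) {c : ℝ} (hc : 0 < c) :
    ∃ K : ℝ≥0, ∀ y : ℝ≥0, ∫⁻ t in Ioi (0 : ℝ), ENNReal.ofReal (r * t ^ (r - 1)) *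
      {t : ℝ | c * t < y}.indicator (fun t => ENNReal.ofReal (C (y / t))) t ≤
        K * (y : ℝ≥0∞) ^ r := by
  have hfin := h.lintegral_Ioi_lt_top hC hc
  set I := ∫⁻ t in Ioi c, ENNReal.ofReal (C t / t ^ r * (1 / t)) with hI
  refine ⟨r.toNNReal * I.toNNReal, fun y => ?_⟩
  rw [ENNReal.coe_mul, ENNReal.coe_toNNReal hfin.ne]
  rcases eq_or_ne y 0 with rfl | hy
  · refine le_of_eq_of_le ?_ zero_le
    refine (setLIntegral_congr_fun (g := fun _ => 0) measurableSet_Ioi fun t ht => ?_).trans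
      (by simp)
    have : t ∉ {t : ℝ | c * t < (0 : ℝ≥0)} := by
      simpa using (mul_pos hc (show (0 : ℝ) < t from ht)).le
    simp only [indicator_of_notMem this, mul_zero]
  have hy0 : (0 : ℝ) < y := by positivity
  have himg : (fun u : ℝ => y / u) '' Ioi c = Ioo 0 (y / c) := by
    ext t
    simp only [mem_image, mem_Ioi, mem_Ioo]
    constructor
    · rintro ⟨u, hu, rfl⟩
      have hu0 := hc.trans hu
      exact ⟨by positivity, by gcongr⟩
    · rintro ⟨h1, h2⟩
      refine ⟨y / t, ?_, by field_simp⟩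
      rw [lt_div_iff₀ hc] at h2
      rw [lt_div_iff₀ h1]
      linarith
  -- The substitution `t = y / u` maps `(c, ∞)` onto `(0, y / c)` and turns `t ^ (r - 1) C(y / t)
  -- dt` into `y ^ r` times the `B_r` integrand.
  have hcv := lintegral_image_eq_lintegral_abs_deriv_mul (s := Ioi c)
    (f := fun u : ℝ => y / u) (f' := fun u => -(y / u ^ 2)) measurableSet_Ioi
    (fun u hu => by
      have hu0 : u ≠ 0 := (hc.trans hu).ne'
      have := ((hasDerivAt_inv hu0).const_mul (y : ℝ)).hasDerivWithinAt (s := Ioi c)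
      simp only [div_eq_mul_inv]
      exact this.congr_deriv (by ring))
    (fun u hu v hv huv => by
      have hu0 : u ≠ 0 := (hc.trans hu).ne'
      have hv0 : v ≠ 0 := (hc.trans hv).ne'
      simp only at huv
      field_simp at huv
      exact huv.symm)
    (fun t => ENNReal.ofReal (r * t ^ (r - 1)) * ENNReal.ofReal (C (y / t)))
  calc ∫⁻ t in Ioi (0 : ℝ), ENNReal.ofReal (r * t ^ (r - 1)) *
        {t : ℝ | c * t < y}.indicator (fun t => ENNReal.ofReal (C (y / t))) t
      = ∫⁻ t in Ioi (0 : ℝ), (Ioo 0 (y / c : ℝ)).indicator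
          (fun t => ENNReal.ofReal (r * t ^ (r - 1)) * ENNReal.ofReal (C (y / t))) t := by
        refine setLIntegral_congr_fun measurableSet_Ioi fun t ht => ?_
        have ht' : (0 : ℝ) < t := ht
        by_cases htc : c * t < y
        · have h1 : t ∈ Ioo 0 (y / c : ℝ) := ⟨ht, by rw [lt_div_iff₀ hc]; linarith⟩
          simp only [indicator_of_mem h1]
          rw [indicator_of_mem (show t ∈ {t : ℝ | c * t < y} from htc)]
        · have h1 : t ∉ Ioo 0 (y / c : ℝ) := fun h1 => htc (by
            have := h1.2
            rw [lt_div_iff₀ hc] at this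
            linarith)
          simp only [indicator_of_notMem h1]
          rw [indicator_of_notMem (show t ∉ {t : ℝ | c * t < y} from htc), mul_zero]
    _ ≤ ∫⁻ t, (Ioo 0 (y / c : ℝ)).indicator
          (fun t => ENNReal.ofReal (r * t ^ (r - 1)) * ENNReal.ofReal (C (y / t))) t :=
        setLIntegral_le_lintegral _ _
    _ = ∫⁻ u in Ioi c, ENNReal.ofReal |-(y / u ^ 2 : ℝ)| *
          (ENNReal.ofReal (r * (y / u : ℝ) ^ (r - 1)) * ENNReal.ofReal (C (y / (y / u)))) := by
        rw [lintegral_indicator measurableSet_Ioo, ← himg, hcv]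
    _ = ∫⁻ u in Ioi c, (ENNReal.ofReal r * (y : ℝ≥0∞) ^ r) *
          ENNReal.ofReal (C u / u ^ r * (1 / u)) := by
        refine setLIntegral_congr_fun measurableSet_Ioi fun u hu => ?_
        have hu0 : 0 < u := hc.trans hu
        have hCu := hC.nonneg hu0.le
        have e1 : (y : ℝ) / (y / u) = u := by field_simp
        have e2 : (y : ℝ≥0∞) ^ r = ENNReal.ofReal ((y : ℝ) ^ r) := by
          rw [← ENNReal.ofReal_rpow_of_nonneg y.coe_nonneg hr.le, ENNReal.ofReal_coe_nnreal]
        rw [e1, e2, ← ENNReal.ofReal_mul (by positivity), ← ENNReal.ofReal_mul (by positivity),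
          ← ENNReal.ofReal_mul (by positivity), ← ENNReal.ofReal_mul (by positivity)]
        congr 1
        rw [abs_neg, abs_of_pos (by positivity), Real.div_rpow hy0.le hu0.le,
          Real.rpow_sub_one hy0.ne', Real.rpow_sub_one hu0.ne']
        have := (Real.rpow_pos_of_pos hu0 r).ne'
        field_simp
    _ = ENNReal.ofReal r * I * (y : ℝ≥0∞) ^ r := by
        rw [lintegral_const_mul' _ _ (ENNReal.mul_ne_top (by simp)
          (ENNReal.rpow_ne_top_of_nonneg hr.le (by simp))), ← hI]
        ring

/-- The Luxemburg maximal operator along a nested partition is bounded on `L^r`. -/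
theorem exists_lintegral_luxemburgAvg_rpow_le {n : ℕ} {J : Type*} [Countable J] {C : ℝ → ℝ}
    {r : ℝ} (hC : IsYoungFunction C) (hr : 0 < r) (h : SatisfiesBr r C) :
    ∃ K : ℝ≥0, ∀ (𝓟 : NestedPartition (Fin n → ℝ) J),
      (∀ k x, volume (𝓟.cell k (𝓟.idx k x)) ≠ ⊤) →
      ∀ g : (Fin n → ℝ) → ℝ≥0, Measurable g →
        ∫⁻ x, (⨆ k, luxemburgAvg C (fun y => (g y : ℝ≥0∞)) (𝓟.cell k (𝓟.idx k x))) ^ r ≤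
          K * ∫⁻ x, (g x : ℝ≥0∞) ^ r := by
  -- With `C c ≤ 1 / 2`, the points where `g ≤ c * t` contribute at most `|Q| / 2` at height `t` and
  -- can be absorbed. What remains is truncated to `g > c * t`, which keeps the `B_r` integral away
  -- from 0.
  obtain ⟨c, hc, hCc⟩ := hC.exists_le (ε := 1 / 2) (by norm_num)
  obtain ⟨K, hK⟩ := h.exists_lintegral_le hC hr hc
  refine ⟨2 * K, fun 𝓟 hfin g hg => ?_⟩
  set M : (Fin n → ℝ) → ℝ≥0∞ :=
    fun x => ⨆ k, luxemburgAvg C (fun y => (g y : ℝ≥0∞)) (𝓟.cell k (𝓟.idx k x)) with hM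
  have hMm : Measurable M := .iSup fun k => 𝓟.measurable_comp_idx k
    fun j => luxemburgAvg C (fun y => (g y : ℝ≥0∞)) (𝓟.cell k j)
  let H : (Fin n → ℝ) → ℝ → ℝ≥0∞ := fun x t =>
    {t : ℝ | c * t < g x}.indicator (fun t => youngExt C (ENNReal.ofReal (g x / t))) t
  have hweak : ∀ t : ℝ, 0 < t →
      volume {x | ENNReal.ofReal t < M x} ≤ 2 * ∫⁻ x, H x t := by
    intro t ht
    have hset : {x | ENNReal.ofReal t < M x} = {x | ∃ k, ENNReal.ofReal t <
        luxemburgAvg C (fun y => (g y : ℝ≥0∞)) (𝓟.cell k (𝓟.idx k x))} := by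
      ext x
      simp [hM, lt_iSup_iff]
    rw [hset, ← lintegral_const_mul' _ _ (by norm_num)]
    refine 𝓟.measure_exists_le volume (P := fun k j => ENNReal.ofReal t <
      luxemburgAvg C (fun y => (g y : ℝ≥0∞)) (𝓟.cell k j)) fun k x hkx => ?_
    set Q := 𝓟.cell k (𝓟.idx k x)
    have h1 := measure_le_lintegral_of_lt_luxemburgAvg (l := t.toNNReal) (by simpa using ht)
      (hfin k x) hkx
    have hpt : ∀ y, youngExt C ((g y : ℝ≥0∞) / t.toNNReal) ≤ 2⁻¹ + H y t := by
      intro y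
      have e : (g y : ℝ≥0∞) / t.toNNReal = (g y / t.toNNReal : ℝ≥0) := by
        rw [ENNReal.coe_div (by simpa using ht)]
      have e' : youngExt C ((g y : ℝ≥0∞) / t.toNNReal) = ENNReal.ofReal (C (g y / t)) := by
        rw [e, youngExt, if_neg ENNReal.coe_ne_top, ENNReal.coe_toReal, NNReal.coe_div,
          Real.coe_toNNReal _ ht.le]
      rw [e']
      by_cases hy : c * t < g y
      · refine le_trans ?_ le_add_self
        simp only [H]
        rw [indicator_of_mem (show t ∈ {t : ℝ | c * t < g y} from hy),
          youngExt_ofReal (by positivity)]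
      · refine le_trans ?_ le_self_add
        have h2 : (g y : ℝ) / t ≤ c := by
          rw [div_le_iff₀ ht]
          exact not_lt.1 hy
        have h3 : C (g y / t) ≤ 1 / 2 :=
          (hC.monotoneOn (mem_Ici.2 (by positivity)) hc.le h2).trans hCc
        refine (ENNReal.ofReal_le_ofReal h3).trans (le_of_eq ?_)
        rw [one_div, ENNReal.ofReal_inv_of_pos two_pos]
        simp
    have h2 : volume Q ≤ volume Q / 2 + ∫⁻ y in Q, H y t := by
      calc volume Q ≤ ∫⁻ y in Q, (2⁻¹ + H y t) := h1.trans (lintegral_mono hpt)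
        _ = _ := by
          rw [lintegral_add_left measurable_const, setLIntegral_const, mul_comm, div_eq_mul_inv]
    have h4 : volume Q / 2 + volume Q / 2 ≤ volume Q / 2 + ∫⁻ y in Q, H y t := by
      rwa [ENNReal.add_halves]
    have h5 := (ENNReal.add_le_add_iff_left (ENNReal.div_ne_top (hfin k x) two_ne_zero)).1 h4
    rw [lintegral_const_mul' _ _ (by norm_num)]
    calc volume Q = 2 * (volume Q / 2) := (ENNReal.mul_div_cancel two_ne_zero (by norm_num)).symm
      _ ≤ _ := by gcongr
  have hHm : Measurable (Function.uncurry H) := by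
    change Measurable ({p : (Fin n → ℝ) × ℝ | c * p.2 < g p.1}.indicator
        fun p => youngExt C (ENNReal.ofReal (g p.1 / p.2)))
    refine Measurable.indicator (hC.measurable_youngExt.comp (by fun_prop)) ?_
    exact measurableSet_lt (by fun_prop) (by fun_prop)
  have hm1 : Measurable fun t : ℝ => ENNReal.ofReal (r * t ^ (r - 1)) := by fun_prop
  calc ∫⁻ x, M x ^ r
      ≤ ∫⁻ x, ∫⁻ t in Ioi (0 : ℝ), ENNReal.ofReal (r * t ^ (r - 1)) *
          {t | ENNReal.ofReal t < M x}.indicator 1 t :=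
        lintegral_mono fun x => ENNReal.rpow_le_lintegral_Ioi hr _
    _ = ∫⁻ t in Ioi (0 : ℝ), ∫⁻ x, ENNReal.ofReal (r * t ^ (r - 1)) *
          {t | ENNReal.ofReal t < M x}.indicator 1 t := by
        refine lintegral_lintegral_swap (Measurable.aemeasurable ?_)
        refine (hm1.comp measurable_snd).mul ?_
        have : (fun p : (Fin n → ℝ) × ℝ => {t | ENNReal.ofReal t < M p.1}.indicator
            (1 : ℝ → ℝ≥0∞) p.2) = {p : (Fin n → ℝ) × ℝ | ENNReal.ofReal p.2 < M p.1}.indicator 1 := by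
          ext p
          simp [indicator]
        rw [this]
        exact measurable_one.indicator (measurableSet_lt (by fun_prop) (by fun_prop))
    _ = ∫⁻ t in Ioi (0 : ℝ), ENNReal.ofReal (r * t ^ (r - 1)) *
          volume {x | ENNReal.ofReal t < M x} := by
        congr! 2 with t
        rw [lintegral_const_mul' _ _ (by simp)]
        congr 1
        rw [← lintegral_indicator_one (measurableSet_lt (by fun_prop) hMm)]
        rfl
    _ ≤ ∫⁻ t in Ioi (0 : ℝ), ENNReal.ofReal (r * t ^ (r - 1)) * (2 * ∫⁻ x, H x t) :=
        setLIntegral_mono' measurableSet_Ioi fun t ht => mul_le_mul_right (hweak t ht) _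
    _ = 2 * ∫⁻ t in Ioi (0 : ℝ), ∫⁻ x, ENNReal.ofReal (r * t ^ (r - 1)) * H x t := by
        rw [← lintegral_const_mul' _ _ (by norm_num)]
        congr! 2 with t
        rw [lintegral_const_mul' _ _ (by simp)]
        ring
    _ = 2 * ∫⁻ x, ∫⁻ t in Ioi (0 : ℝ), ENNReal.ofReal (r * t ^ (r - 1)) * H x t := by
        rw [lintegral_lintegral_swap (Measurable.aemeasurable ?_)]
        exact (hm1.comp measurable_fst).mul (hHm.comp measurable_swap)
    _ ≤ 2 * ∫⁻ x, K * (g x : ℝ≥0∞) ^ r := by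
        refine mul_le_mul_right (lintegral_mono fun x => le_of_eq_of_le ?_ (hK (g x))) _
        refine setLIntegral_congr_fun measurableSet_Ioi fun t ht => ?_
        have ht' : (0 : ℝ) < t := ht
        simp only [H, indicator, youngExt_ofReal (show 0 ≤ (g x : ℝ) / t by positivity)]
    _ = _ := by
        rw [lintegral_const_mul' _ _ (by simp)]
        push_cast
        ring

/-! ### Shifted dyadic grids and the one-third trick -/

noncomputable section

section grid

variable {n : ℕ}

/-- The displacement, relative to the side length, of the shifted dyadic grid at scale `z`. -/
def gridShift (b : Bool) (z : ℤ) : ℝ := if b then (-1) ^ z / 3 else 0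

/-- The sign of the shift alternates with the scale, so twice a shift minus the next one is three
times the shift. Its being an integer is what makes the shifted grid nested. -/
lemma exists_int_eq_three_mul_gridShift (b : Bool) (z : ℤ) :
    ∃ e : ℤ, (e : ℝ) = 3 * gridShift b z := by
  cases b
  · exact ⟨0, by simp [gridShift]⟩
  · rcases Int.even_or_odd z with h | h
    · exact ⟨1, by simp [gridShift, h.neg_one_zpow]⟩
    · exact ⟨-1, by norm_num [gridShift, h.neg_one_zpow]⟩

lemma gridShift_add_one (b : Bool) (z : ℤ) : gridShift b (z + 1) = -gridShift b z := by
  cases b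
  · simp [gridShift]
  · simp [gridShift, zpow_add_one₀, neg_div]

/-- The label of the cube with side length `2 ^ (-z)` of the grid shifted by `τ` that contains
a given point. -/
def gridIdx (τ : Fin n → Bool) (z : ℤ) (x : Fin n → ℝ) : Fin n → ℤ :=
  fun j => ⌊2 ^ z * x j - gridShift (τ j) z⌋

/-- The cube with side length `2 ^ (-z)` of the grid shifted by `τ` that contains `x`. -/
def gridCell (τ : Fin n → Bool) (z : ℤ) (x : Fin n → ℝ) : Set (Fin n → ℝ) :=
  gridIdx τ z ⁻¹' {gridIdx τ z x}

lemma floor_eq_floor_of_two_mul_add {u v : ℝ} {e : ℤ} (h : ⌊2 * u + e⌋ = ⌊2 * v + e⌋) :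
    ⌊u⌋ = ⌊v⌋ := by
  rw [Int.floor_add_intCast, Int.floor_add_intCast, add_left_inj] at h
  symm
  rw [Int.floor_eq_iff]
  have h1 := Int.floor_le u
  have h2 := Int.lt_floor_add_one u
  have h3 : 2 * ⌊u⌋ ≤ ⌊2 * u⌋ := Int.le_floor.2 (by push_cast; linarith)
  have h4 : ⌊2 * u⌋ < 2 * ⌊u⌋ + 2 := Int.floor_lt.2 (by push_cast; linarith)
  rw [h] at h3 h4
  have h5 := Int.floor_le (2 * v)
  have h6 := Int.lt_floor_add_one (2 * v)
  have h7 : ⌊2 * v⌋ + 1 ≤ 2 * ⌊u⌋ + 2 := h4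
  have h8 : (2 : ℝ) * ⌊u⌋ ≤ ⌊2 * v⌋ := by exact_mod_cast h3
  have h9 : (⌊2 * v⌋ : ℝ) + 1 ≤ 2 * ⌊u⌋ + 2 := by exact_mod_cast h7
  constructor <;> linarith

lemma gridIdx_eq_of_add_one {τ : Fin n → Bool} {z : ℤ} {x y : Fin n → ℝ}
    (h : gridIdx τ (z + 1) x = gridIdx τ (z + 1) y) : gridIdx τ z x = gridIdx τ z y := by
  ext j
  obtain ⟨e, he⟩ := exists_int_eq_three_mul_gridShift (τ j) z
  have key : ∀ x : Fin n → ℝ, 2 ^ (z + 1) * x j - gridShift (τ j) (z + 1) =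
      2 * (2 ^ z * x j - gridShift (τ j) z) + e := fun x => by
    rw [gridShift_add_one, he, zpow_add_one₀ two_ne_zero]
    ring
  have hj := congrFun h j
  simp only [gridIdx, key] at hj
  exact floor_eq_floor_of_two_mul_add hj

lemma measurable_gridIdx (τ : Fin n → Bool) (z : ℤ) : Measurable (gridIdx τ z) :=
  measurable_pi_lambda _ fun j => Int.measurable_floor.comp (by fun_prop)

/-- The cubes of side length at most `2 ^ N` of a shifted dyadic grid. -/
def gridPartition (τ : Fin n → Bool) (N : ℕ) : NestedPartition (Fin n → ℝ) (Fin n → ℤ) where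
  idx k := gridIdx τ (k - N)
  measurableSet_preimage k j := measurable_gridIdx τ _ (measurableSet_singleton j)
  nested k x y h := by
    refine gridIdx_eq_of_add_one ?_
    convert h using 2 <;> push_cast <;> ring

lemma gridPartition_cell (τ : Fin n → Bool) (N k : ℕ) (x : Fin n → ℝ) :
    (gridPartition τ N).cell k ((gridPartition τ N).idx k x) = gridCell τ (k - N) x := rfl

lemma gridCell_eq_pi (τ : Fin n → Bool) (z : ℤ) (x : Fin n → ℝ) : gridCell τ z x =
    univ.pi fun j => Ico ((gridIdx τ z x j + gridShift (τ j) z) * 2 ^ (-z))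
      ((gridIdx τ z x j + gridShift (τ j) z) * 2 ^ (-z) + 2 ^ (-z)) := by
  have hz : (0 : ℝ) < 2 ^ z := by positivity
  ext y
  simp only [gridCell, mem_preimage, mem_singleton_iff, funext_iff, mem_pi, mem_univ, true_imp_iff,
    mem_Ico]
  refine forall_congr' fun j => ?_
  change ⌊_⌋ = _ ↔ _
  rw [Int.floor_eq_iff, zpow_neg, ← div_eq_mul_inv, div_le_iff₀ hz,
    show ∀ s : ℝ, s / 2 ^ z + (2 ^ z)⁻¹ = (s + 1) / 2 ^ z from fun s => by ring, lt_div_iff₀ hz]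
  constructor <;> rintro ⟨h1, h2⟩ <;> constructor <;> linarith

lemma exists_gridCell_ae_eq_cube (τ : Fin n → Bool) (z : ℤ) (x : Fin n → ℝ) :
    ∃ a, gridCell τ z x =ᵐ[volume] cube a (2 ^ (-z)) := by
  refine ⟨fun j => (gridIdx τ z x j + gridShift (τ j) z) * 2 ^ (-z), ?_⟩
  rw [gridCell_eq_pi]
  exact Measure.univ_pi_Ico_ae_eq_Icc

lemma volume_cube (a : Fin n → ℝ) (l : ℝ) : volume (cube a l) = ENNReal.ofReal l ^ n := by
  simp [cube, Real.volume_Icc_pi]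

lemma volume_gridCell (τ : Fin n → Bool) (z : ℤ) (x : Fin n → ℝ) :
    volume (gridCell τ z x) = ENNReal.ofReal (2 ^ (-z)) ^ n := by
  obtain ⟨a, ha⟩ := exists_gridCell_ae_eq_cube τ z x
  rw [measure_congr ha, volume_cube]

lemma volume_gridCell_ne_zero (τ : Fin n → Bool) (z : ℤ) (x : Fin n → ℝ) :
    volume (gridCell τ z x) ≠ 0 := by
  rw [volume_gridCell]
  exact pow_ne_zero _ (by simp; positivity)

lemma volume_gridCell_ne_top (τ : Fin n → Bool) (z : ℤ) (x : Fin n → ℝ) :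
    volume (gridCell τ z x) ≠ ⊤ := by
  rw [volume_gridCell]
  exact ENNReal.pow_ne_top ENNReal.ofReal_ne_top

/-- If an integer separates `u` from `u + d`, both lie within `1 / 3` of it, so no point of the
lattice shifted by `±1 / 3` separates them. -/
lemma exists_floor_sub_gridShift_eq (u d : ℝ) (hd0 : 0 ≤ d) (hd : d < 1 / 3) (z : ℤ) :
    ∃ b, ⌊u + d - gridShift b z⌋ = ⌊u - gridShift b z⌋ := by
  have h1 := Int.floor_le u
  have h2 := Int.lt_floor_add_one u
  by_cases h : ⌊u + d⌋ = ⌊u⌋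
  · exact ⟨false, by simpa [gridShift] using h⟩
  refine ⟨true, ?_⟩
  have h3 : (⌊u⌋ : ℝ) + 1 ≤ u + d := by
    by_contra! h3
    exact h (Int.floor_eq_iff.2 ⟨by linarith, h3⟩)
  rcases Int.even_or_odd z with hz | hz
  · simp only [gridShift, hz.neg_one_zpow, if_true]
    trans ⌊u⌋
    · exact Int.floor_eq_iff.2 ⟨by linarith, by linarith⟩
    · exact (Int.floor_eq_iff.2 ⟨by linarith, by linarith⟩).symm
  · simp only [gridShift, hz.neg_one_zpow, if_true]
    trans ⌊u⌋ + 1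
    · exact Int.floor_eq_iff.2 ⟨by push_cast; linarith, by push_cast; linarith⟩
    · exact (Int.floor_eq_iff.2 ⟨by push_cast; linarith, by push_cast; linarith⟩).symm

/-- Every cube is contained in a cube of comparable size from one of the shifted grids. -/
lemma exists_cube_subset_gridCell (a : Fin n → ℝ) {l : ℝ} (hl : 0 < l) :
    ∃ (τ : Fin n → Bool) (z : ℤ), (2 : ℝ) ^ (-z) ≤ 6 * l ∧
      ∀ x ∈ cube a l, cube a l ⊆ gridCell τ z x := by
  -- From `6 * l < 2 * 2 ^ m` the rescaled side is below `1 / 3`, as the one-third trick requires in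
  -- each coordinate.
  obtain ⟨m, hm1, hm2⟩ := exists_mem_Ico_zpow (x := 6 * l) (by positivity) one_lt_two
  rw [zpow_add_one₀ two_ne_zero] at hm2
  have hm0 : (0 : ℝ) < 2 ^ m := by positivity
  have hd : 2 ^ (-m) * l < 1 / 3 := by
    rw [zpow_neg, inv_mul_lt_iff₀ hm0]
    linarith
  choose τ hτ using fun j => exists_floor_sub_gridShift_eq (2 ^ (-m) * a j) (2 ^ (-m) * l)
    (by positivity) hd (-m)
  have key : ∀ x ∈ cube a l, gridIdx τ (-m) x = gridIdx τ (-m) a := by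
    rintro x ⟨hx1, hx2⟩
    ext j
    refine le_antisymm ?_ ?_
    · rw [gridIdx, gridIdx, ← hτ j, ← mul_add]
      gcongr
      exact hx2 j
    · unfold gridIdx
      gcongr
      exact hx1 j
  refine ⟨τ, -m, by simpa using hm1, fun x hx y hy => ?_⟩
  exact (key y hy).trans (key x hx).symm

end grid

/-! ### Reduction to dyadic maximal functions -/

section fracMaximal

variable {n m : ℕ}

/-- The quantity whose supremum over all cubes containing a point is the fractional maximal
function. -/
def fracAvg (α : ℝ) (B : ℝ → ℝ) (g : Fin m → (Fin n → ℝ) → ℝ≥0∞) (Q : Set (Fin n → ℝ)) : ℝ≥0∞ :=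
  volume Q ^ (α / n) * ∏ i, luxemburgAvg B (g i) Q

/-- The fractional maximal function over the cubes of side length at most `2 ^ N` of a shifted
dyadic grid. -/
def gridMaximal (α : ℝ) (B : ℝ → ℝ) (g : Fin m → (Fin n → ℝ) → ℝ≥0∞) (τ : Fin n → Bool) (N : ℕ)
    (x : Fin n → ℝ) : ℝ≥0∞ :=
  ⨆ k, fracAvg α B g ((gridPartition τ N).cell k ((gridPartition τ N).idx k x))

variable {α : ℝ} {B : ℝ → ℝ} {g : Fin m → (Fin n → ℝ) → ℝ≥0∞}

lemma measurable_gridMaximal (τ : Fin n → Bool) (N : ℕ) :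
    Measurable (gridMaximal α B g τ N) :=
  .iSup fun k => (gridPartition τ N).measurable_comp_idx k
    fun j => fracAvg α B g ((gridPartition τ N).cell k j)

/-- Raising the largest scale by one only relabels level `k` as level `k + 1`. -/
lemma monotone_gridMaximal (τ : Fin n → Bool) : Monotone (gridMaximal α B g τ) := by
  refine monotone_nat_of_le_succ fun N x => iSup_le fun k => ?_
  refine le_iSup_of_le (k + 1) (le_of_eq ?_)
  rw [gridPartition_cell, gridPartition_cell]
  congr 2
  push_cast
  ring

lemma fracAvg_le_mul (hα : 0 ≤ α) (hB : IsYoungFunction B) {Q P : Set (Fin n → ℝ)} (hQP : Q ⊆ P)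
    {D : ℝ≥0} (hD : 1 ≤ D) (hPQ : volume P ≤ D * volume Q) (hQ0 : volume Q ≠ 0)
    (hP : volume P ≠ ⊤) : fracAvg α B g Q ≤ D ^ m * fracAvg α B g P := by
  unfold fracAvg
  calc volume Q ^ (α / n) * ∏ i, luxemburgAvg B (g i) Q
      ≤ volume P ^ (α / n) * ∏ i, D * luxemburgAvg B (g i) P := by
        gcongr
        exact luxemburgAvg_le_mul hB hQP hD hPQ hQ0 hP
    _ = _ := by
        rw [Finset.prod_mul_distrib, Finset.prod_const, Finset.card_univ, Fintype.card_fin]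
        ring

lemma fracMaximal_le {𝕜 : Type*} [RCLike 𝕜] (hα : 0 ≤ α) (hB : IsYoungFunction B)
    (f : Fin m → (Fin n → ℝ) → 𝕜) (x : Fin n → ℝ) :
    fracMaximal α B f x ≤ (6 ^ n) ^ m *
      ⨆ τ, ⨆ N, gridMaximal α B (fun i y => ‖f i y‖ₑ) τ N x := by
  refine iSup₂_le fun a l => iSup₂_le fun hl hx => ?_
  obtain ⟨τ, z, hz, hsub⟩ := exists_cube_subset_gridCell a hl
  have h1 : volume (gridCell τ z x) ≤ ((6 ^ n : ℝ≥0) : ℝ≥0∞) * volume (cube a l) := by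
    rw [volume_gridCell, volume_cube]
    push_cast
    rw [← mul_pow]
    gcongr
    calc ENNReal.ofReal (2 ^ (-z)) ≤ ENNReal.ofReal (6 * l) := ENNReal.ofReal_le_ofReal hz
      _ = _ := by rw [ENNReal.ofReal_mul (by norm_num)]; norm_num
  have h2 := fracAvg_le_mul (α := α) (g := fun i y => ‖f i y‖ₑ) hα hB (hsub x hx)
    (one_le_pow₀ (by norm_num)) h1 (by rw [volume_cube]; exact pow_ne_zero _ (by simpa using hl))
    (volume_gridCell_ne_top τ z x)
  refine h2.trans ?_
  push_cast
  gcongr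
  -- `N` and `k` are natural numbers chosen so that `k - N = z`, for either sign of `z`.
  refine le_iSup_of_le τ (le_iSup_of_le (-z).toNat (le_iSup_of_le
    (z + (-z).toNat).toNat (le_of_eq ?_)))
  rw [gridPartition_cell]
  congr 2
  omega

end fracMaximal

end

/-! ### Sparseness, the bump condition and the dyadic estimate -/

section bounds

variable {n m : ℕ} {α p q : ℝ} {B : ℝ → ℝ}

/-- The power of the volume only decreases on smaller cells, so a gain of `(4m)^m` in the product
forces a gain of `4m` in some factor. The weak-type bound confines this, for each `i`, to measure
`|S| / (2m)`; the `m` factors together give half of `S`. -/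
lemma isSparse_fracAvg (hα : 0 ≤ α) (hm : 1 ≤ m) (hB : IsYoungFunction B)
    (g : Fin m → (Fin n → ℝ) → ℝ≥0∞) (τ : Fin n → Bool) (N : ℕ) :
    (gridPartition τ N).IsSparse volume
      (fun k j => fracAvg α B g ((gridPartition τ N).cell k j)) ((2 * (2 * m)) ^ m) := by
  intro k x
  set 𝓟 := gridPartition τ N with h𝓟
  set S := 𝓟.cell k (𝓟.idx k x) with hS
  have hS0 : volume S ≠ 0 := volume_gridCell_ne_zero τ _ x
  have hSt : volume S ≠ ⊤ := volume_gridCell_ne_top τ _ x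
  have hsub : ∀ y ∈ S, ∀ k' > k, 𝓟.cell k' (𝓟.idx k' y) ⊆ S := fun y hy k' hk' => by
    have := 𝓟.cell_subset_cell hk'.le y
    rwa [show 𝓟.idx k y = 𝓟.idx k x from hy] at this
  have hα' : 0 ≤ α / n := by positivity
  have hV0 : volume S ^ (α / n) ≠ 0 := by simp [ENNReal.rpow_eq_zero_iff, hS0, hSt]
  have hm0 : (m : ℝ≥0∞) ≠ 0 := by
    have : m ≠ 0 := by omega
    exact_mod_cast this
  have hmr : (1 : ℝ≥0) ≤ 2 * m := by
    have : (1 : ℝ≥0) ≤ m := by exact_mod_cast hm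
    linarith
  -- A vanishing factor on `S` vanishes on every subcell, so nothing there can exceed the value on
  -- `S`. It is settled before the infinite case because `0 * ⊤ = 0`.
  by_cases h0 : ∃ i, luxemburgAvg B (g i) S = 0
  · obtain ⟨i, hi⟩ := h0
    have : {y ∈ S | ∃ k' > k, (2 * (2 * m)) ^ m * fracAvg α B g S <
        fracAvg α B g (𝓟.cell k' (𝓟.idx k' y))} = ∅ := by
      refine eq_empty_of_forall_notMem ?_
      rintro y ⟨hy, k', hk', hlt⟩
      have hQ0 : volume (𝓟.cell k' (𝓟.idx k' y)) ≠ 0 := volume_gridCell_ne_zero τ _ y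
      have hQt : volume (𝓟.cell k' (𝓟.idx k' y)) ≠ ⊤ := volume_gridCell_ne_top τ _ y
      have hD : volume S / volume (𝓟.cell k' (𝓟.idx k' y)) ≠ ⊤ := ENNReal.div_ne_top hSt hQ0
      have hlux := luxemburgAvg_le_mul (g := g i) hB (hsub y hy k' hk')
        (D := max 1 (volume S / volume (𝓟.cell k' (𝓟.idx k' y))).toNNReal) (le_max_left _ _)
        (by
          rw [← ENNReal.div_le_iff hQ0 hQt]
          calc volume S / volume (𝓟.cell k' (𝓟.idx k' y))
              = (volume S / volume (𝓟.cell k' (𝓟.idx k' y))).toNNReal :=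
                (ENNReal.coe_toNNReal hD).symm
            _ ≤ _ := by exact_mod_cast le_max_right _ _) hQ0 hSt
      rw [hi, mul_zero, nonpos_iff_eq_zero] at hlux
      have : fracAvg α B g (𝓟.cell k' (𝓟.idx k' y)) = 0 := by
        rw [fracAvg, Finset.prod_eq_zero (Finset.mem_univ i) hlux, mul_zero]
      rw [this] at hlt
      exact not_lt_zero hlt
    rw [this]
    simp
  push Not at h0
  by_cases ht : ∃ i, luxemburgAvg B (g i) S = ⊤
  · obtain ⟨i, hi⟩ := ht
    have hprod : ∏ i, luxemburgAvg B (g i) S = ⊤ := by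
      rw [← Finset.mul_prod_erase _ _ (Finset.mem_univ i), hi, ENNReal.top_mul]
      exact Finset.prod_ne_zero_iff.2 fun j _ => h0 j
    have htop : (2 * (2 * (m : ℝ≥0∞))) ^ m * fracAvg α B g S = ⊤ := by
      rw [fracAvg, hprod, ENNReal.mul_top hV0, ENNReal.mul_top]
      exact pow_ne_zero _ (by simp [hm0])
    simp [← hS, htop]
  push Not at ht
  -- The average is an infimum, positive and finite by now, so some admissible `l` lies below its
  -- double. This costs one of the two factors 2 in `2 * (2 * m)`.
  have hl : ∀ i, ∃ l : ℝ≥0, 0 < l ∧ (l : ℝ≥0∞) < 2 * luxemburgAvg B (g i) S ∧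
      ⨍⁻ y in S, youngExt B (g i y / l) ∂volume ≤ 1 := fun i => by
    refine exists_of_luxemburgAvg_lt ?_
    rw [two_mul]
    exact ENNReal.lt_add_right (ht i) (h0 i)
  choose l hl0 hl2 hl1 using hl
  let U : Fin m → Set (Fin n → ℝ) := fun i => {y | ∃ k', 𝓟.cell k' (𝓟.idx k' y) ⊆ S ∧
    ((l i * (2 * m) : ℝ≥0) : ℝ≥0∞) < luxemburgAvg B (g i) (𝓟.cell k' (𝓟.idx k' y))}
  have hU : ∀ i, volume (U i) ≤ volume S / (2 * m : ℝ≥0) := fun i => by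
    calc volume (U i)
        ≤ ∫⁻ y, S.indicator (fun y => youngExt B (g i y / (l i * (2 * m) : ℝ≥0))) y := by
          refine 𝓟.measure_exists_le volume (P := fun k' j => 𝓟.cell k' j ⊆ S ∧
            ((l i * (2 * m) : ℝ≥0) : ℝ≥0∞) < luxemburgAvg B (g i) (𝓟.cell k' j)) ?_
          rintro k' y ⟨h1, h2⟩
          refine (measure_le_lintegral_of_lt_luxemburgAvg (mul_pos (hl0 i) (by linarith))
            (volume_gridCell_ne_top τ _ y) h2).trans (le_of_eq ?_)
          refine setLIntegral_congr_fun (𝓟.measurableSet_cell _ _) fun z hz => ?_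
          rw [indicator_of_mem (h1 hz)]
      _ = ∫⁻ y in S, youngExt B (g i y / (l i * (2 * m) : ℝ≥0)) :=
          lintegral_indicator (𝓟.measurableSet_cell _ _) _
      _ ≤ ∫⁻ y in S, youngExt B (g i y / l i) / (2 * m : ℝ≥0) := by
          refine lintegral_mono fun y => ?_
          have : g i y / (l i * (2 * m) : ℝ≥0) = g i y / l i / (2 * m : ℝ≥0) := by
            rw [ENNReal.coe_mul, div_eq_mul_inv, ENNReal.mul_inv (.inr ENNReal.coe_ne_top)
              (.inl ENNReal.coe_ne_top), ← mul_assoc, ← div_eq_mul_inv, ← div_eq_mul_inv]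
          rw [this]
          exact hB.youngExt_div_le _ hmr
      _ = (∫⁻ y in S, youngExt B (g i y / l i)) / (2 * m : ℝ≥0) := by
          simp_rw [div_eq_mul_inv]
          exact lintegral_mul_const' _ _ (by simp [hm0])
      _ ≤ _ := by
          have := hl1 i
          rw [setLAverage_eq, ENNReal.div_le_iff hS0 hSt, one_mul] at this
          gcongr
  have hDU : {y ∈ S | ∃ k' > k, (2 * (2 * (m : ℝ≥0∞))) ^ m * fracAvg α B g S <
      fracAvg α B g (𝓟.cell k' (𝓟.idx k' y))} ⊆ ⋃ i, U i := by
    rintro y ⟨hy, k', hk', hlt⟩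
    by_contra hyU
    simp only [mem_iUnion, not_exists] at hyU
    refine absurd hlt (not_lt.2 ?_)
    have hi : ∀ i, luxemburgAvg B (g i) (𝓟.cell k' (𝓟.idx k' y)) ≤
        2 * (2 * m) * luxemburgAvg B (g i) S := fun i => by
      by_contra! hcon
      refine hyU i ⟨k', hsub y hy k' hk', lt_of_le_of_lt ?_ hcon⟩
      calc ((l i * (2 * m) : ℝ≥0) : ℝ≥0∞) = l i * (2 * m) := by push_cast; rfl
        _ ≤ 2 * luxemburgAvg B (g i) S * (2 * m) := by
          gcongr
          exact (hl2 i).le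
        _ = _ := by ring
    calc fracAvg α B g (𝓟.cell k' (𝓟.idx k' y))
        ≤ volume S ^ (α / n) * ∏ i, 2 * (2 * m) * luxemburgAvg B (g i) S := by
          unfold fracAvg
          gcongr with i
          · exact hsub y hy k' hk'
          · exact hi i
      _ = _ := by
          rw [Finset.prod_mul_distrib, Finset.prod_const, Finset.card_univ, Fintype.card_fin,
            fracAvg]
          ring
  calc 2 * volume {y ∈ S | ∃ k' > k, (2 * (2 * (m : ℝ≥0∞))) ^ m * fracAvg α B g S <
        fracAvg α B g (𝓟.cell k' (𝓟.idx k' y))}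
      ≤ 2 * ∑ i, volume (U i) := by
        gcongr
        exact (measure_mono hDU).trans (measure_iUnion_fintype_le _ _)
    _ ≤ 2 * ∑ _ : Fin m, volume S / (2 * m : ℝ≥0) := by
        gcongr with i
        exact hU i
    _ = (2 * m) * (volume S / (2 * m)) := by
        rw [Finset.sum_const, Finset.card_univ, Fintype.card_fin, nsmul_eq_mul]
        push_cast
        ring
    _ = volume S := ENNReal.mul_div_cancel (by simp [hm0]) (by finiteness)

/-- The bump condition bounds the weighted contribution of a grid cube. -/
lemma fracAvg_rpow_mul_lintegral_le {A C : Fin m → ℝ → ℝ} (hp : 0 < p) (hq : 0 < q)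
    (hB : IsYoungFunction B) (hA : ∀ i, IsYoungFunction (A i)) (hC : ∀ i, IsYoungFunction (C i))
    (hABC : ∀ i, ∀ t, 0 < t → youngInv (A i) t * youngInv (C i) t ≤ youngInv B t)
    {ν : (Fin n → ℝ) → ℝ≥0} {w : Fin m → (Fin n → ℝ) → ℝ≥0} (hw : ∀ i, AEMeasurable (w i) volume)
    (hbump : bumpConstant α p q A ν w < ⊤) (f : Fin m → (Fin n → ℝ) → ℝ≥0)
    (τ : Fin n → Bool) (z : ℤ) (x : Fin n → ℝ) :
    fracAvg α B (fun i y => (f i y : ℝ≥0∞)) (gridCell τ z x) ^ q *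
      ∫⁻ y in gridCell τ z x, (ν y : ℝ≥0∞) ^ q ≤
    ((4 ^ m * (bumpConstant α p q A ν w).toNNReal) ^ q : ℝ≥0) *
      (volume (gridCell τ z x) *
        ∏ i, luxemburgAvg (C i) (fun y => (f i y * w i y : ℝ≥0)) (gridCell τ z x) ^ p) ^ (q / p) := by
  obtain ⟨a, ha⟩ := exists_gridCell_ae_eq_cube τ z x
  have hv0 := volume_gridCell_ne_zero τ z x
  have hvt := volume_gridCell_ne_top τ z x
  set S := gridCell τ z x
  set I := ∫⁻ y in S, (ν y : ℝ≥0∞) ^ q with hI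
  -- Only when `ν` has positive mass on the cell does the bump condition force the averages of `w⁻¹`
  -- to be finite, as Hölder's inequality needs.
  rcases eq_or_ne I 0 with hI0 | hI0
  · simp [hI0]
  set v := volume S
  set X : Fin m → ℝ≥0∞ := fun i => luxemburgAvg (C i) (fun y => (f i y * w i y : ℝ≥0)) S with hX
  set Y : Fin m → ℝ≥0∞ := fun i => luxemburgAvg (A i) (fun y => (w i y : ℝ≥0∞)⁻¹) S with hY
  have hY0 : ∀ i, Y i ≠ 0 := fun i => luxemburgAvg_ne_zero (hA i) (by have := hw i; fun_prop)
    (fun y => by simp) hv0 hvt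
  have hb : v ^ (α / n + 1 / q - 1 / p) * (I / v) ^ (1 / q) * ∏ i, Y i ≤
      bumpConstant α p q A ν w := by
    have h1 : v ^ (α / n + 1 / q - 1 / p) * (I / v) ^ (1 / q) * ∏ i, Y i =
        volume (cube a (2 ^ (-z))) ^ (α / n + 1 / q - 1 / p) *
      (⨍⁻ x in cube a (2 ^ (-z)), (ν x : ℝ≥0∞) ^ q ∂volume) ^ (1 / q) *
      ∏ i, luxemburgAvg (A i) (fun x => (w i x : ℝ≥0∞)⁻¹) (cube a (2 ^ (-z))) := by
      simp only [hY, v, hI, ← setLAverage_eq]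
      rw [measure_congr ha, setLAverage_congr ha]
      simp only [luxemburgAvg_congr_set ha]
    rw [h1]
    exact le_iSup₂_of_le a (2 ^ (-z)) (le_iSup_of_le (by positivity) le_rfl)
  have hYt : ∀ i, Y i ≠ ⊤ := fun i hi => by
    have hprod : ∏ i, Y i = ⊤ := by
      rw [← Finset.mul_prod_erase _ _ (Finset.mem_univ i), hi, ENNReal.top_mul]
      exact Finset.prod_ne_zero_iff.2 fun j _ => hY0 j
    rw [hprod, ENNReal.mul_top, top_le_iff] at hb
    · exact hbump.ne hb
    · refine mul_ne_zero (by simp [ENNReal.rpow_eq_zero_iff, hv0, hvt]) ?_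
      have : I / v ≠ 0 := ENNReal.div_ne_zero.2 ⟨hI0, hvt⟩
      simp [ENNReal.rpow_eq_zero_iff, this, not_lt.2 hq.le]
  have hlux : ∀ i, luxemburgAvg B (fun y => (f i y : ℝ≥0∞)) S ≤ 4 * (Y i * X i) := fun i => by
    have := luxemburgAvg_le_mul_luxemburgAvg (f := f i) hB (hA i) (hC i) (hABC i) (hw i)
      (hY0 i) (hYt i) hv0 hvt
    simpa only [hX, ENNReal.coe_mul] using this
  have hv : v ^ (α / n) * I ^ (1 / q) =
      v ^ (1 / p) * (v ^ (α / n + 1 / q - 1 / p) * (I / v) ^ (1 / q)) := by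
    rw [ENNReal.div_rpow_of_nonneg _ _ (by positivity), div_eq_mul_inv (I ^ (1 / q)),
      ← ENNReal.rpow_neg, show α / n = 1 / p + (α / n + 1 / q - 1 / p) + -(1 / q) by ring,
      ENNReal.rpow_add _ _ hv0 hvt, ENNReal.rpow_add _ _ hv0 hvt]
    ring_nf
  have key : fracAvg α B (fun i y => (f i y : ℝ≥0∞)) S * I ^ (1 / q) ≤
      4 ^ m * bumpConstant α p q A ν w * (v ^ (1 / p) * ∏ i, X i) := by
    calc fracAvg α B (fun i y => (f i y : ℝ≥0∞)) S * I ^ (1 / q)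
        ≤ v ^ (α / n) * (∏ i, 4 * (Y i * X i)) * I ^ (1 / q) := by
          unfold fracAvg
          gcongr with i
          exact hlux i
      _ = 4 ^ m * (∏ i, Y i) * (∏ i, X i) * (v ^ (α / n) * I ^ (1 / q)) := by
          rw [Finset.prod_mul_distrib, Finset.prod_mul_distrib, Finset.prod_const,
            Finset.card_univ, Fintype.card_fin]
          ring
      _ = 4 ^ m * (v ^ (α / n + 1 / q - 1 / p) * (I / v) ^ (1 / q) * ∏ i, Y i) *
            (v ^ (1 / p) * ∏ i, X i) := by
          rw [hv]
          ring
      _ ≤ _ := by gcongr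
  have h1 : fracAvg α B (fun i y => (f i y : ℝ≥0∞)) S ^ q * I =
      (fracAvg α B (fun i y => (f i y : ℝ≥0∞)) S * I ^ (1 / q)) ^ q := by
    rw [ENNReal.mul_rpow_of_nonneg _ _ hq.le, ← ENNReal.rpow_mul, one_div_mul_cancel hq.ne',
      ENNReal.rpow_one]
  have h2 : (v * ∏ i, X i ^ p) ^ (q / p) = (v ^ (1 / p) * ∏ i, X i) ^ q := by
    have : v * ∏ i, X i ^ p = (v ^ (1 / p) * ∏ i, X i) ^ p := by
      rw [ENNReal.mul_rpow_of_nonneg _ _ hp.le, ← ENNReal.rpow_mul, one_div_mul_cancel hp.ne',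
        ENNReal.rpow_one, ENNReal.prod_rpow_of_nonneg hp.le]
    rw [this, ← ENNReal.rpow_mul, mul_div_cancel₀ _ hp.ne']
  have h3 : (((4 ^ m * (bumpConstant α p q A ν w).toNNReal) ^ q : ℝ≥0) : ℝ≥0∞) =
      (4 ^ m * bumpConstant α p q A ν w) ^ q := by
    rw [ENNReal.coe_rpow_of_nonneg _ hq.le]
    push_cast
    rw [ENNReal.coe_toNNReal hbump.ne]
  rw [h1, h2, h3, ← ENNReal.mul_rpow_of_nonneg _ _ hq.le]
  gcongr

/-- The boundedness of the maximal operators for `C i`, combined with Hölder's inequality. -/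
lemma exists_lintegral_iSup_prod_le {C : Fin m → ℝ → ℝ} {P : Fin m → ℝ} (hp0 : 0 < p)
    (hP : ∀ i, 0 < P i) (hp : 1 / p = ∑ i, 1 / P i) (hC : ∀ i, IsYoungFunction (C i))
    (hCB : ∀ i, SatisfiesBr (P i) (C i)) :
    ∃ K : Fin m → ℝ≥0, ∀ g : Fin m → (Fin n → ℝ) → ℝ≥0, (∀ i, AEMeasurable (g i)) →
      ∀ (τ : Fin n → Bool) (N : ℕ),
      ∫⁻ x, (⨆ k, ∏ i, luxemburgAvg (C i) (fun y => (g i y : ℝ≥0∞))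
        ((gridPartition τ N).cell k ((gridPartition τ N).idx k x)) ^ p) ≤
      ∏ i, (K i * ∫⁻ x, (g i x : ℝ≥0∞) ^ P i) ^ (p / P i) := by
  choose K hK using fun i => exists_lintegral_luxemburgAvg_rpow_le (n := n) (J := Fin n → ℤ)
    (hC i) (hP i) (hCB i)
  refine ⟨K, fun g hg τ N => ?_⟩
  set 𝓟 := gridPartition τ N
  let M : Fin m → (Fin n → ℝ) → ℝ≥0∞ := fun i x => ⨆ k, luxemburgAvg (C i)
    (fun y => (g i y : ℝ≥0∞)) (𝓟.cell k (𝓟.idx k x))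
  have hMm : ∀ i, Measurable (M i) := fun i => .iSup fun k => 𝓟.measurable_comp_idx k
    fun j => luxemburgAvg (C i) (fun y => (g i y : ℝ≥0∞)) (𝓟.cell k j)
  have hM : ∀ i, ∫⁻ x, M i x ^ P i ≤ K i * ∫⁻ x, (g i x : ℝ≥0∞) ^ P i := fun i => by
    -- The maximal bound asks for a measurable function; Luxemburg averages and the integral do not
    -- see null sets.
    obtain ⟨g', hg', hgg'⟩ := hg i
    have hae : (fun y => (g i y : ℝ≥0∞)) =ᵐ[volume] fun y => (g' y : ℝ≥0∞) :=
      hgg'.mono fun y hy => congrArg _ hy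
    have h1 := hK i 𝓟 (fun k x => volume_gridCell_ne_top τ _ x) g' hg'
    simp only [← luxemburgAvg_congr_fun hae] at h1
    refine h1.trans (le_of_eq ?_)
    congr 1
    exact lintegral_congr_ae (hae.mono fun y hy => congrArg (· ^ P i) hy.symm)
  calc ∫⁻ x, (⨆ k, ∏ i, luxemburgAvg (C i) (fun y => (g i y : ℝ≥0∞))
        (𝓟.cell k (𝓟.idx k x)) ^ p)
      ≤ ∫⁻ x, ∏ i, (M i x ^ P i) ^ (p / P i) := by
        refine lintegral_mono fun x => iSup_le fun k => Finset.prod_le_prod' fun i _ => ?_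
        rw [← ENNReal.rpow_mul, mul_div_cancel₀ _ (hP i).ne']
        gcongr
        exact le_iSup (fun k => luxemburgAvg (C i) (fun y => (g i y : ℝ≥0∞))
          (𝓟.cell k (𝓟.idx k x))) k
    _ ≤ ∏ i, (∫⁻ x, M i x ^ P i) ^ (p / P i) := by
        -- The Hölder weights `p / P i` sum to 1 by the definition of `p`.
        refine ENNReal.lintegral_prod_norm_pow_le _
          (fun i _ => ((hMm i).pow_const _).aemeasurable) ?_
          (fun i _ => (div_pos hp0 (hP i)).le)
        simp_rw [div_eq_mul_one_div p]
        rw [← Finset.mul_sum, ← hp, mul_one_div_cancel hp0.ne']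
    _ ≤ _ := by
        gcongr with i
        · exact (div_pos hp0 (hP i)).le
        · exact hM i

/-- The weighted estimate for the dyadic fractional maximal functions. -/
theorem exists_lintegral_gridMaximal_le {A C : Fin m → ℝ → ℝ} {P : Fin m → ℝ} (hα : 0 ≤ α)
    (hm : 1 ≤ m) (hp0 : 0 < p) (hpq : p ≤ q) (hP : ∀ i, 0 < P i) (hp : 1 / p = ∑ i, 1 / P i)
    (hB : IsYoungFunction B) (hA : ∀ i, IsYoungFunction (A i)) (hC : ∀ i, IsYoungFunction (C i))
    (hABC : ∀ i, ∀ t, 0 < t → youngInv (A i) t * youngInv (C i) t ≤ youngInv B t)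
    (hCB : ∀ i, SatisfiesBr (P i) (C i))
    {ν : (Fin n → ℝ) → ℝ≥0} {w : Fin m → (Fin n → ℝ) → ℝ≥0} (hw : ∀ i, AEMeasurable (w i) volume)
    (hbump : bumpConstant α p q A ν w < ⊤) :
    ∃ K : ℝ≥0, ∀ f : Fin m → (Fin n → ℝ) → ℝ≥0, (∀ i, AEMeasurable (fun x => f i x * w i x)) →
      ∀ (τ : Fin n → Bool) (N : ℕ),
      ∫⁻ x, gridMaximal α B (fun i y => (f i y : ℝ≥0∞)) τ N x ^ q
        ∂(volume.withDensity fun x => (ν x : ℝ≥0∞) ^ q) ≤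
      (K * ∏ i, (∫⁻ x, ((f i x * w i x : ℝ≥0) : ℝ≥0∞) ^ P i) ^ (1 / P i)) ^ q := by
  have hq : 0 < q := hp0.trans_le hpq
  obtain ⟨L, hL⟩ := exists_lintegral_iSup_prod_le (n := n) hp0 hP hp hC hCB
  set D : ℝ≥0 := 4 ^ m * (bumpConstant α p q A ν w).toNNReal
  refine ⟨(2 * (2 * m)) ^ m * D * (2 ^ (1 / p) * ∏ i, L i ^ (1 / P i)), fun f hf τ N => ?_⟩
  have hmr : (1 : ℝ≥0∞) ≤ m := by exact_mod_cast hm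
  -- The exponent is `s = q / p ≥ 1`, and `b` is the product of the `p`-th powers of the `C i`
  -- averages of `f i * w i`.
  have hmain := (gridPartition τ N).lintegral_iSup_rpow_le (μ := volume)
    (σ := volume.withDensity fun x => (ν x : ℝ≥0∞) ^ q)
    (a := fun k j => fracAvg α B (fun i y => (f i y : ℝ≥0∞)) ((gridPartition τ N).cell k j))
    (b := fun k j => ∏ i, luxemburgAvg (C i) (fun y => (f i y * w i y : ℝ≥0))
      ((gridPartition τ N).cell k j) ^ p) (R := (2 * (2 * m)) ^ m) (K := (D ^ q : ℝ≥0))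
    hq ((one_le_div hp0).2 hpq)
    (one_le_pow₀ (le_trans (by norm_num) (mul_le_mul' le_rfl (mul_le_mul' le_rfl hmr))))
    (isSparse_fracAvg hα hm hB _ τ N) (fun k x => volume_gridCell_ne_top τ _ x)
    (fun k x => by
      rw [withDensity_apply _ ((gridPartition τ N).measurableSet_cell _ _)]
      exact fracAvg_rpow_mul_lintegral_le hp0 hq hB hA hC hABC hw hbump f τ _ x)
  refine hmain.trans ?_
  calc ((2 * (2 * (m : ℝ≥0∞))) ^ m) ^ q * ((D ^ q : ℝ≥0) * (2 * ∫⁻ x, ⨆ k,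
        ∏ i, luxemburgAvg (C i) (fun y => (f i y * w i y : ℝ≥0))
          ((gridPartition τ N).cell k ((gridPartition τ N).idx k x)) ^ p) ^ (q / p))
      ≤ ((2 * (2 * (m : ℝ≥0∞))) ^ m) ^ q * ((D ^ q : ℝ≥0) *
        (2 * ∏ i, (L i * ∫⁻ x, ((f i x * w i x : ℝ≥0) : ℝ≥0∞) ^ P i) ^ (p / P i)) ^ (q / p)) := by
        gcongr
        exact hL (fun i x => f i x * w i x) hf τ N
    _ = _ := by
        have h1 : 2 * ∏ i, (L i * ∫⁻ x, ((f i x * w i x : ℝ≥0) : ℝ≥0∞) ^ P i) ^ (p / P i) =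
            (2 ^ (1 / p) * ∏ i, (L i * ∫⁻ x, ((f i x * w i x : ℝ≥0) : ℝ≥0∞) ^ P i) ^
              (1 / P i)) ^ p := by
          rw [ENNReal.mul_rpow_of_nonneg _ _ hp0.le, ← ENNReal.rpow_mul,
            one_div_mul_cancel hp0.ne', ENNReal.rpow_one, ← ENNReal.prod_rpow_of_nonneg hp0.le]
          simp_rw [← ENNReal.rpow_mul, one_div_mul_eq_div]
        have h2 : ∀ i, (L i * ∫⁻ x, ((f i x * w i x : ℝ≥0) : ℝ≥0∞) ^ P i) ^ (1 / P i) =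
            ((L i ^ (1 / P i) : ℝ≥0) : ℝ≥0∞) *
              (∫⁻ x, ((f i x * w i x : ℝ≥0) : ℝ≥0∞) ^ P i) ^ (1 / P i) := fun i => by
          have := (one_div_pos.2 (hP i)).le
          rw [ENNReal.mul_rpow_of_nonneg _ _ this, ENNReal.coe_rpow_of_nonneg _ this]
        rw [h1, ← ENNReal.rpow_mul, mul_div_cancel₀ _ hp0.ne',
          ENNReal.coe_rpow_of_nonneg _ hq.le, ← ENNReal.mul_rpow_of_nonneg _ _ hq.le,
          ← ENNReal.mul_rpow_of_nonneg _ _ hq.le]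
        congr 1
        simp_rw [h2]
        rw [Finset.prod_mul_distrib]
        push_cast
        rw [ENNReal.coe_rpow_of_nonneg _ (by positivity)]
        push_cast
        ring

end bounds

/-! ### The main theorem -/

theorem mainTheorem1 {𝕜 : Type*} [RCLike 𝕜] (n m : ℕ) (α p q : ℝ) (P : Fin m → ℝ)
    (hα0 : 0 ≤ α) (hα : α < n * m)
    (hP : ∀ i, 1 < P i) (hp : 1 / p = ∑ i, 1 / P i)
    (hmp : 1 / (m : ℝ) < p) (hpq : p ≤ q)
    (B : ℝ → ℝ) (A C : Fin m → ℝ → ℝ)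
    (hB : IsYoungFunction B) (hA : ∀ i, IsYoungFunction (A i)) (hC : ∀ i, IsYoungFunction (C i))
    (hABC : ∀ i, ∀ t, 0 < t → youngInv (A i) t * youngInv (C i) t ≤ youngInv B t)
    (hCd : ∀ i, IsDoublingYoung (C i)) (hCB : ∀ i, SatisfiesBr (P i) (C i))
    (ν : (Fin n → ℝ) → ℝ≥0) (w : Fin m → (Fin n → ℝ) → ℝ≥0)
    (hν : AEMeasurable ν volume) (hw : ∀ i, AEMeasurable (w i) volume)
    (hbump : bumpConstant α p q A ν w < ⊤) :
    ∃ K : ℝ≥0, ∀ f : Fin m → (Fin n → ℝ) → 𝕜,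
      (∀ i, MemLp (f i) (ENNReal.ofReal (P i))
        (volume.withDensity fun x => (w i x : ℝ≥0∞) ^ P i)) →
      eLpNorm (fun x => fracMaximal α B f x * (ν x : ℝ≥0∞)) (ENNReal.ofReal q) volume ≤
        K * ∏ i, eLpNorm (fun x => ‖f i x‖ₑ * (w i x : ℝ≥0∞)) (ENNReal.ofReal (P i)) volume := by
  have hp0 : 0 < p := lt_of_le_of_lt (by positivity) hmp
  have hq : 0 < q := hp0.trans_le hpq
  have hP0 : ∀ i, 0 < P i := fun i => one_pos.trans (hP i)
  have hm : 1 ≤ m := by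
    rcases Nat.eq_zero_or_pos m with rfl | h
    · simp at hα
      linarith
    · exact h
  obtain ⟨K, hK⟩ := exists_lintegral_gridMaximal_le hα0 hm hp0 hpq hP0 hp hB hA hC hABC hCB hw hbump
  -- The factor `(6 ^ n) ^ m` comes from enlarging cubes to grid cells, and the cardinality to the
  -- power `1 / q` from summing over the shifts.
  refine ⟨(6 ^ n) ^ m * ((Fintype.card (Fin n → Bool) : ℝ≥0) ^ (1 / q) * K), fun f hf => ?_⟩
  -- The weighted measure ignores the zero set of `w i`, so `f i` need not be measurable there, but
  -- the product with `w i` vanishes on it.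
  have hfw : ∀ i, AEMeasurable (fun x => ‖f i x‖₊ * w i x) := fun i => by
    have hwP : AEMeasurable (fun x => (w i x : ℝ≥0∞) ^ P i) :=
      ((hw i).coe_nnreal_ennreal).pow_const _
    have h1 := (hf i).1.ae_eq_mk
    rw [Filter.EventuallyEq, ae_withDensity_iff' hwP] at h1
    refine (((hf i).1.stronglyMeasurable_mk.measurable.nnnorm.aemeasurable).mul
      (hw i)).congr ?_
    filter_upwards [h1] with x hx
    by_cases hwx : w i x = 0
    · simp [hwx]
    · rw [Pi.mul_apply, hx]
      simp [ENNReal.rpow_eq_zero_iff, hwx]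
  set T : ℝ≥0∞ := ∏ i, (∫⁻ x, ((‖f i x‖₊ * w i x : ℝ≥0) : ℝ≥0∞) ^ P i) ^ (1 / P i) with hT
  have hTe : ∏ i, eLpNorm (fun x => ‖f i x‖ₑ * (w i x : ℝ≥0∞)) (ENNReal.ofReal (P i)) volume
      = T := by
    refine Finset.prod_congr rfl fun i _ => ?_
    rw [eLpNorm_eq_lintegral_rpow_enorm_toReal (by simpa using hP0 i) ENNReal.ofReal_ne_top,
      ENNReal.toReal_ofReal (hP0 i).le]
    simp only [enorm_eq_self, ENNReal.coe_mul, enorm_eq_nnnorm]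
  set σ := volume.withDensity fun x => (ν x : ℝ≥0∞) ^ q with hσ
  let g : Fin m → (Fin n → ℝ) → ℝ≥0∞ := fun i y => ‖f i y‖ₑ
  let F : (Fin n → Bool) → ℕ → (Fin n → ℝ) → ℝ≥0∞ := gridMaximal α B g
  have hFm : ∀ τ N, Measurable (F τ N) := fun τ N => measurable_gridMaximal τ N
  -- The dyadic bound is uniform in `N`, so monotone convergence extends it to all scales.
  have hFsup : ∀ τ, ∫⁻ x, (⨆ N, F τ N x) ^ q ∂σ ≤ (K * T) ^ q := fun τ => by
    have h1 : ∀ x, (⨆ N, F τ N x) ^ q = ⨆ N, F τ N x ^ q := fun x =>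
      (ENNReal.orderIsoRpow q hq).map_iSup _
    simp_rw [h1]
    rw [lintegral_iSup (fun N => (hFm τ N).pow_const q) fun N N' h x =>
      ENNReal.rpow_le_rpow (monotone_gridMaximal τ h x) hq.le]
    exact iSup_le fun N => hK (fun i x => ‖f i x‖₊) hfw τ N
  have hpt : ∀ x, (fracMaximal α B f x * ν x) ^ q ≤
      ((6 ^ n) ^ m) ^ q * ((ν x : ℝ≥0∞) ^ q * ∑ τ, (⨆ N, F τ N x) ^ q) := by
    intro x
    have h1 : (⨆ τ, ⨆ N, F τ N x) ^ q ≤ ∑ τ, (⨆ N, F τ N x) ^ q := by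
      rw [← ENNReal.le_rpow_inv_iff hq]
      refine iSup_le fun τ => ?_
      rw [ENNReal.le_rpow_inv_iff hq]
      exact Finset.single_le_sum (f := fun τ => (⨆ N, F τ N x) ^ q) (fun _ _ => zero_le)
        (Finset.mem_univ τ)
    rw [ENNReal.mul_rpow_of_nonneg _ _ hq.le]
    calc fracMaximal α B f x ^ q * (ν x : ℝ≥0∞) ^ q
        ≤ ((6 ^ n) ^ m * ⨆ τ, ⨆ N, F τ N x) ^ q * (ν x : ℝ≥0∞) ^ q := by
          gcongr
          exact fracMaximal_le hα0 hB f x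
      _ = ((6 ^ n) ^ m) ^ q * ((ν x : ℝ≥0∞) ^ q * (⨆ τ, ⨆ N, F τ N x) ^ q) := by
          rw [ENNReal.mul_rpow_of_nonneg _ _ hq.le]
          ring
      _ ≤ _ := by gcongr
  have hFmq : ∀ τ, Measurable fun x => (⨆ N, F τ N x) ^ q := fun τ =>
    (Measurable.iSup (hFm τ)).pow_const q
  have hint : ∫⁻ x, (fracMaximal α B f x * ν x) ^ q ≤
      ((6 ^ n) ^ m) ^ q * ((Fintype.card (Fin n → Bool) : ℝ≥0∞) * (K * T) ^ q) := by
    calc ∫⁻ x, (fracMaximal α B f x * ν x) ^ q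
        ≤ ∫⁻ x, ((6 ^ n) ^ m) ^ q * ((ν x : ℝ≥0∞) ^ q * ∑ τ, (⨆ N, F τ N x) ^ q) :=
          lintegral_mono hpt
      _ = ((6 ^ n) ^ m) ^ q * ∫⁻ x, ∑ τ, (⨆ N, F τ N x) ^ q ∂σ := by
          rw [lintegral_const_mul' _ _ (by finiteness), hσ,
            lintegral_withDensity_eq_lintegral_mul₀ (hν.coe_nnreal_ennreal.pow_const q)
              (Finset.measurable_fun_sum _ fun τ _ => hFmq τ).aemeasurable]
          rfl
      _ ≤ _ := by
          rw [lintegral_finsetSum _ fun τ _ => hFmq τ]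
          gcongr
          refine (Finset.sum_le_sum fun τ _ => hFsup τ).trans (le_of_eq ?_)
          rw [Finset.sum_const, Finset.card_univ, nsmul_eq_mul]
  rw [hTe, eLpNorm_eq_lintegral_rpow_enorm_toReal (by simpa using hq) ENNReal.ofReal_ne_top,
    ENNReal.toReal_ofReal hq.le, one_div, ENNReal.rpow_inv_le_iff hq]
  simp only [enorm_eq_self]
  refine hint.trans (le_of_eq ?_)
  push_cast
  rw [ENNReal.coe_rpow_of_nonneg _ (by positivity), mul_assoc, mul_assoc,
    ENNReal.mul_rpow_of_nonneg ((6 ^ n) ^ m) _ hq.le,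
    ENNReal.mul_rpow_of_nonneg (_ ^ q⁻¹) _ hq.le, ← ENNReal.rpow_mul, inv_mul_cancel₀ hq.ne',
    ENNReal.rpow_one, ENNReal.coe_natCast]
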